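/- Let $(M,J,\omega)$ be a compact Hermitian manifold with smooth boundary $\partial M$, of complex dimension $n\ge 2$, let $\bar M=M\cup\partial M$, and let $\chi$ be a smooth real $(1,1)$-form on $\bar M$. For $u\in C^2(\bar M)$ put $\mathfrak g[u]=\chi+\sqrt{-1}\,\partial\bar\partial u$, and let $\lambda(\mathfrak g[u])=(\lambda_1,\dots,\lambda_n)$ be the eigenvalues of $\mathfrak g[u]$ with respect to $\omega$. Let $\Gamma\subset\mathbb R^n$ be an open symmetric convex cone with vertex at the origin and $\partial\Gamma\ne\emptyset$, containing $\{\lambda:\lambda_i>0 \text{ for all } i\}$. Let $f\in C^\infty(\Gamma)\cap C(\bar\Gamma)$ be symmetric and concave in $\Gamma$ with $\partial f/\partial\lambda_i>0$ in $\Gamma$ for all $i$, and put $F(\mathfrak g[u])=f(\lambda(\mathfrak g[u]))$. Let $\psi\in C(\bar M)$ satisfy the degeneracy condition $$\inf_M\psi=\sup_{\partial\Gamma}f:=\sup_{\lambda_0\in\partial\Gamma}\limsup_{\lambda\to\lambda_0}f(\lambda).$$ A function $v\in C^2(\bar M)$ is called admissible if $\lambda(\mathfrak g[v])\in\Gamma$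 on $\bar M$. For $\varphi:\partial M\to\mathbb R$, a function $u\in C(\bar M)$ is called a weak $C^0$-solution of $$F(\mathfrak g[u])=\psi \text{ in } M,\qquad u=\varphi \text{ on } \partial M,$$ if there is a function $C(\epsilon)$ with $C(\epsilon)\to0$ as $\epsilon\to0^+$ such that for every $\epsilon>0$ there are an admissible $\tilde u\in C^2(\bar M)$ and a function $\rho_\epsilon$ with $|u-\tilde u|<\epsilon$ on $\bar M$, $0<\rho_\epsilon<C(\epsilon)$ in $M$, $F(\mathfrak g[\tilde u])=\psi+\rho_\epsilon$ in $M$ and $\tilde u=\varphi$ on $\partial M$. **Theorem.** If $u^1,u^2$ are weak $C^0$-solutions with boundary data $\varphi^1,\varphi^2$ respectively (and the same $\psi$), then $$\sup_M|u^1-u^2|\le\sup_{\partial M}|\varphi^1-\varphi^2|.$$ Consequently, for fixed boundary data $\varphi$ there is at most one weak $C^0$-solution. -/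

import Mathlib

open Set Filter Topology Manifold Bundle
open scoped ContDiff

/-- An integrable almost complex structure, smooth up to the boundary, on a real smooth manifold
`M` (possibly with boundary): a smooth field `J` of endomorphisms of the tangent bundle with
`J² = -1` and vanishing Nijenhuis tensor. This makes `M` a complex manifold with boundary. -/
structure ComplexStructure {E : Type*} [NormedAddCommGroup E] [NormedSpace ℝ E]
    {H : Type*} [TopologicalSpace H] (I : ModelWithCorners ℝ E H)
    (M : Type*) [TopologicalSpace M] [ChartedSpace H M] [IsManifold I ∞ M] where
  J : ∀ x : M, TangentSpace I x →L[ℝ] TangentSpace I x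
  smooth : ContMDiff I (I.prod 𝓘(ℝ, E →L[ℝ] E)) ∞
    (fun x ↦ TotalSpace.mk' (E →L[ℝ] E) (E := fun x : M ↦ TangentSpace I x →L[ℝ] TangentSpace I x)
      x (J x))
  sq : ∀ (x : M) (v : TangentSpace I x), J x (J x v) = -v
  integrable : ∀ X Y : (∀ x : M, TangentSpace I x),
    ContMDiff I I.tangent ∞ (fun x ↦ (⟨x, X x⟩ : TangentBundle I M)) →
    ContMDiff I I.tangent ∞ (fun x ↦ (⟨x, Y x⟩ : TangentBundle I M)) →
    ∀ x : M,
      VectorField.mlieBracket I (fun z ↦ J z (X z)) (fun z ↦ J z (Y z)) x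
        - J x (VectorField.mlieBracket I (fun z ↦ J z (X z)) Y x)
        - J x (VectorField.mlieBracket I X (fun z ↦ J z (Y z)) x)
        - VectorField.mlieBracket I X Y x = 0

/-- A Hermitian metric: a smooth Riemannian metric `g` with `g (J v) (J w) = g v w`. -/
structure HermitianMetric {E : Type*} [NormedAddCommGroup E] [NormedSpace ℝ E]
    {H : Type*} [TopologicalSpace H] {I : ModelWithCorners ℝ E H}
    {M : Type*} [TopologicalSpace M] [ChartedSpace H M] [IsManifold I ∞ M]
    (𝒥 : ComplexStructure I M) where
  g : ContMDiffRiemannianMetric I ∞ E (fun x : M ↦ TangentSpace I x)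
  compat : ∀ (x : M) (v w : TangentSpace I x), g.inner x (𝒥.J x v) (𝒥.J x w) = g.inner x v w

/-- The Kähler form `ω v w = g (J v) w` of a Hermitian metric, at the point `x`. -/
noncomputable def HermitianMetric.kahlerForm {E : Type*} [NormedAddCommGroup E] [NormedSpace ℝ E]
    {H : Type*} [TopologicalSpace H] {I : ModelWithCorners ℝ E H}
    {M : Type*} [TopologicalSpace M] [ChartedSpace H M] [IsManifold I ∞ M]
    {𝒥 : ComplexStructure I M} (h : HermitianMetric 𝒥) (x : M) :
    TangentSpace I x →L[ℝ] TangentSpace I x →L[ℝ] ℝ :=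
  (h.g.inner x).comp (𝒥.J x)

/-- A smooth real `(1,1)`-form: a smooth field of alternating, `J`-invariant real bilinear forms. -/
structure RealOneOneForm {E : Type*} [NormedAddCommGroup E] [NormedSpace ℝ E]
    {H : Type*} [TopologicalSpace H] {I : ModelWithCorners ℝ E H}
    {M : Type*} [TopologicalSpace M] [ChartedSpace H M] [IsManifold I ∞ M]
    (𝒥 : ComplexStructure I M) where
  form : ∀ x : M, TangentSpace I x →L[ℝ] TangentSpace I x →L[ℝ] ℝ
  alternating : ∀ (x : M) (v : TangentSpace I x), form x v v = 0
  invariant : ∀ (x : M) (v w : TangentSpace I x), form x (𝒥.J x v) (𝒥.J x w) = form x v w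
  smooth : ContMDiff I (I.prod 𝓘(ℝ, E →L[ℝ] E →L[ℝ] ℝ)) ∞
    (fun x ↦ TotalSpace.mk' (E →L[ℝ] E →L[ℝ] ℝ)
      (E := fun x : M ↦ TangentSpace I x →L[ℝ] TangentSpace I x →L[ℝ] ℝ) x (form x))

/-- The expression of a `1`-form `α` in the chart centred at `p`: its pullback under the inverse of
that chart, a `1`-form on the (closed) model domain `range I ⊆ E`. -/
noncomputable def oneFormInChart {E : Type*} [NormedAddCommGroup E] [NormedSpace ℝ E]
    {H : Type*} [TopologicalSpace H] (I : ModelWithCorners ℝ E H)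
    {M : Type*} [TopologicalSpace M] [ChartedSpace H M]
    (α : ∀ x : M, TangentSpace I x →L[ℝ] ℝ) (p : M) (y : E) : E →L[ℝ] ℝ :=
  (α ((extChartAt I p).symm y)).comp
    (mfderivWithin 𝓘(ℝ, E) I (extChartAt I p).symm (range I) y)

/-- The exterior derivative of a `1`-form `α` at `p`, computed in the chart centred at `p`:
`dα (v, w) = D_v α (w) - D_w α (v)` in coordinates. -/
noncomputable def extDerivOneForm {E : Type*} [NormedAddCommGroup E] [NormedSpace ℝ E]
    {H : Type*} [TopologicalSpace H] (I : ModelWithCorners ℝ E H)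
    {M : Type*} [TopologicalSpace M] [ChartedSpace H M]
    (α : ∀ x : M, TangentSpace I x →L[ℝ] ℝ) (p : M) :
    TangentSpace I p →L[ℝ] TangentSpace I p →L[ℝ] ℝ :=
  let B : E →L[ℝ] E →L[ℝ] ℝ :=
    fderivWithin ℝ (oneFormInChart I α p) (range I) (extChartAt I p p)
  let D : TangentSpace I p →L[ℝ] E := mfderiv I 𝓘(ℝ, E) (extChartAt I p) p
  (ContinuousLinearMap.precomp ℝ D).comp ((B - B.flip).comp D)

/-- The real `(1,1)`-form `√-1 ∂∂̄ u = -(1/2) d (du ∘ J)`. -/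
noncomputable def ddbar {E : Type*} [NormedAddCommGroup E] [NormedSpace ℝ E]
    {H : Type*} [TopologicalSpace H] {I : ModelWithCorners ℝ E H}
    {M : Type*} [TopologicalSpace M] [ChartedSpace H M] [IsManifold I ∞ M]
    (𝒥 : ComplexStructure I M) (u : M → ℝ) (p : M) :
    TangentSpace I p →L[ℝ] TangentSpace I p →L[ℝ] ℝ :=
  (-(1 / 2 : ℝ)) • extDerivOneForm I
    (fun x ↦ ((mfderiv I 𝓘(ℝ, ℝ) u x : TangentSpace I x →L[ℝ] ℝ)).comp (𝒥.J x)) p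

/-- The form `𝔤[u] = χ + √-1 ∂∂̄ u`. -/
noncomputable def gForm {E : Type*} [NormedAddCommGroup E] [NormedSpace ℝ E]
    {H : Type*} [TopologicalSpace H] {I : ModelWithCorners ℝ E H}
    {M : Type*} [TopologicalSpace M] [ChartedSpace H M] [IsManifold I ∞ M]
    {𝒥 : ComplexStructure I M} (χ : RealOneOneForm 𝒥) (u : M → ℝ) (p : M) :
    TangentSpace I p →L[ℝ] TangentSpace I p →L[ℝ] ℝ :=
  χ.form p + ddbar 𝒥 u p

/-- `lam` lists the eigenvalues, with multiplicity, of the real `(1,1)`-form `η` with respect to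
the Kähler form `ω` at `x`: there is an `ω`-unitary frame `e₁, …, eₙ` (orthonormal over `ℂ`) of the
tangent space in which `η` is diagonal with entries `lam₁, …, lamₙ`. In terms of
`Zᵢ = (eᵢ - √-1 J eᵢ) / 2` one has `η (Zᵢ, Z̄ⱼ) = (η (eᵢ, eⱼ) + √-1 η (eᵢ, J eⱼ)) / 2`, so the
conditions say `g_{i j̄} = δ_{ij} / 2` and `η_{i j̄} = lamᵢ δ_{ij} / 2`. When `n` is the complex
dimension, such a list exists and is unique up to a permutation. -/
def IsEigenvalues {E : Type*} [NormedAddCommGroup E] [NormedSpace ℝ E]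
    {H : Type*} [TopologicalSpace H] {I : ModelWithCorners ℝ E H}
    {M : Type*} [TopologicalSpace M] [ChartedSpace H M] [IsManifold I ∞ M]
    {𝒥 : ComplexStructure I M} (h : HermitianMetric 𝒥) {n : ℕ} (x : M)
    (η : TangentSpace I x →L[ℝ] TangentSpace I x →L[ℝ] ℝ) (lam : Fin n → ℝ) : Prop :=
  ∃ e : Fin n → TangentSpace I x, ∀ i j : Fin n,
    h.kahlerForm x (e i) (e j) = 0 ∧
    h.kahlerForm x (e i) (𝒥.J x (e j)) = (if i = j then 1 else 0) ∧
    η (e i) (e j) = 0 ∧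
    η (e i) (𝒥.J x (e j)) = (if i = j then lam i else 0)

/-- An open symmetric convex cone `Γ ⊆ ℝⁿ` with vertex at the origin, containing the positive
cone, with nonempty boundary. -/
structure IsSymmetricCone {n : ℕ} (Γ : Set (Fin n → ℝ)) : Prop where
  isOpen : IsOpen Γ
  convex : Convex ℝ Γ
  cone : ∀ lam ∈ Γ, ∀ t : ℝ, 0 < t → t • lam ∈ Γ
  symm : ∀ lam ∈ Γ, ∀ σ : Equiv.Perm (Fin n), lam ∘ σ ∈ Γ
  pos_subset : {lam : Fin n → ℝ | ∀ i, 0 < lam i} ⊆ Γ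
  frontier_nonempty : (frontier Γ).Nonempty

/-- The conditions on `f`: symmetric, smooth in `Γ`, continuous on the closure of `Γ`, strictly
increasing in each variable in the sense of positive partial derivatives, and concave in `Γ`. -/
structure IsEllipticConcave {n : ℕ} (Γ : Set (Fin n → ℝ)) (f : (Fin n → ℝ) → ℝ) : Prop where
  smooth : ContDiffOn ℝ ∞ f Γ
  continuousOn : ContinuousOn f (closure Γ)
  symm : ∀ lam ∈ Γ, ∀ σ : Equiv.Perm (Fin n), f (lam ∘ σ) = f lam
  elliptic : ∀ lam ∈ Γ, ∀ i : Fin n, 0 < fderiv ℝ f lam (Pi.single i 1)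
  concave : ConcaveOn ℝ Γ f

/-- `sup_{∂Γ} f`: the supremum over `lam₀ ∈ ∂Γ` of `limsup f` at `lam₀` from inside `Γ`. -/
noncomputable def supBoundary {n : ℕ} (Γ : Set (Fin n → ℝ)) (f : (Fin n → ℝ) → ℝ) : EReal :=
  ⨆ lam₀ ∈ frontier Γ, limsup (fun lam ↦ (f lam : EReal)) (𝓝[Γ] lam₀)

/-- `u ∈ C²(M̄)` is admissible: `λ(𝔤[u]) ∈ Γ` at every point of `M̄` (`M` denotes the whole
manifold, boundary included). -/
def IsAdmissible {E : Type*} [NormedAddCommGroup E] [NormedSpace ℝ E]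
    {H : Type*} [TopologicalSpace H] {I : ModelWithCorners ℝ E H}
    {M : Type*} [TopologicalSpace M] [ChartedSpace H M] [IsManifold I ∞ M]
    {𝒥 : ComplexStructure I M} (h : HermitianMetric 𝒥) (χ : RealOneOneForm 𝒥)
    {n : ℕ} (Γ : Set (Fin n → ℝ)) (u : M → ℝ) : Prop :=
  ContMDiff I 𝓘(ℝ, ℝ) 2 u ∧
    ∀ x : M, ∃ lam : Fin n → ℝ, IsEigenvalues h x (gForm χ u x) lam ∧ lam ∈ Γ

/-- `F(𝔤[u]) = f(λ(𝔤[u])) = ψ` in the interior of `M`. -/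
def SolvesInInterior {E : Type*} [NormedAddCommGroup E] [NormedSpace ℝ E]
    {H : Type*} [TopologicalSpace H] {I : ModelWithCorners ℝ E H}
    {M : Type*} [TopologicalSpace M] [ChartedSpace H M] [IsManifold I ∞ M]
    {𝒥 : ComplexStructure I M} (h : HermitianMetric 𝒥) (χ : RealOneOneForm 𝒥)
    {n : ℕ} (f : (Fin n → ℝ) → ℝ) (ψ u : M → ℝ) : Prop :=
  ∀ x ∈ I.interior M, ∃ lam : Fin n → ℝ, IsEigenvalues h x (gForm χ u x) lam ∧ f lam = ψ x

/-- A weak `C⁰`-solution of `F(𝔤[u]) = ψ` with boundary data `φ`: a continuous function `u` on `M̄`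
which, for every `ε > 0`, is within `ε` of a `C²` admissible solution of `F(𝔤[ũ]) = ψ + ρ` with the
same boundary data, where `0 < ρ < C(ε)` and `C(ε) → 0` as `ε → 0`. -/
def IsWeakC0Solution {E : Type*} [NormedAddCommGroup E] [NormedSpace ℝ E]
    {H : Type*} [TopologicalSpace H] {I : ModelWithCorners ℝ E H}
    {M : Type*} [TopologicalSpace M] [ChartedSpace H M] [IsManifold I ∞ M]
    {𝒥 : ComplexStructure I M} (h : HermitianMetric 𝒥) (χ : RealOneOneForm 𝒥)
    {n : ℕ} (Γ : Set (Fin n → ℝ)) (f : (Fin n → ℝ) → ℝ) (ψ : M → ℝ)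
    (φ : I.boundary M → ℝ) (u : M → ℝ) : Prop :=
  Continuous u ∧
    ∃ C : ℝ → ℝ, Tendsto C (𝓝[>] 0) (𝓝 0) ∧
      ∀ ε : ℝ, 0 < ε → ∃ v ρ : M → ℝ,
        IsAdmissible h χ Γ v ∧
        (∀ x, |u x - v x| < ε) ∧
        (∀ x ∈ I.interior M, 0 < ρ x ∧ ρ x < C ε) ∧
        SolvesInInterior h χ f (fun x ↦ ψ x + ρ x) v ∧
        ∀ y : I.boundary M, v y = φ y

/-! The proof is a maximum principle in which one approximant stays fixed while the other improves.
Fix an admissible `v₁` within `ε` of `u₁`; it solves the equation with right-hand side `ψ + ρ₁`, `ρ₁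
> 0` in the interior. Let `v₂ k` approximate `u₂` with errors tending to 0, and let `x k` be a
maximum point of `v₁ - v₂ k`. At an interior maximum `√-1 ∂∂̄ v₁ ≤ √-1 ∂∂̄ (v₂ k)`, so monotonicity
of `f ∘ λ` gives `ρ₁ ≤ ρ₂ k < C (δ k)` there. If the `x k` accumulated at an interior point `p`,
continuity of `ρ₁` would force `ρ₁ p ≤ 0`, which is impossible. Hence they accumulate on the
boundary, where `v₁ - u₂ = φ₁ - φ₂`. Now let `ε → 0`, and exchange the two solutions for the other
inequality. No positive lower bound for `ρ₁` near the boundary is needed.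

Two facts carry this. Monotonicity (`IsDiagonalFrame.map_le_map`) follows Schur and Birkhoff: the
diagonal of a Hermitian form in any unitary frame is a doubly stochastic average of its eigenvalues,
and a symmetric concave `f` does not decrease under such averages. The same argument shows that
membership in `Γ` and the value of `f` do not depend on the diagonalizing frame. Continuity of `ρ₁`
(`IsAdmissible.tendsto_rhs`) follows from compactness of unitary frames. Both need `√-1 ∂∂̄ u` to be
of type (1,1), which is where integrability of `J` enters. -/

/-! ### Linear algebra of unitary frames. -/

section UnitaryFrame

variable {V : Type*} [AddCommGroup V] [Module ℝ V] [TopologicalSpace V] {n : ℕ}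
  [FiniteDimensional ℝ V]

/-- `e` is an orthonormal frame over `ℂ` for the `J`-invariant inner product `g`. -/
structure IsUnitaryFrame (g : V →L[ℝ] V →L[ℝ] ℝ) (J : V →L[ℝ] V) (e : Fin n → V) : Prop where
  orthonormal : ∀ i j, g (e i) (e j) = if i = j then 1 else 0
  orthogonal : ∀ i j, g (e i) (J (e j)) = 0

/-- `g` is an inner product invariant under the complex structure `J`. -/
structure IsHermitianPair (g : V →L[ℝ] V →L[ℝ] ℝ) (J : V →L[ℝ] V) : Prop where
  symm : ∀ v w, g v w = g w v
  pos : ∀ v, v ≠ 0 → 0 < g v v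
  sq : ∀ v, J (J v) = -v
  compat : ∀ v w, g (J v) (J w) = g v w

variable {g : V →L[ℝ] V →L[ℝ] ℝ} {J : V →L[ℝ] V}

omit [FiniteDimensional ℝ V] in
theorem IsHermitianPair.apply_J_left (h : IsHermitianPair g J) (v w : V) :
    g (J v) w = -g v (J w) := by
  have := h.compat v (J w)
  rw [h.sq, map_neg] at this
  linarith

/-- Orthonormality makes the `2n` vectors `e j`, `J (e j)` linearly independent, and the dimension
count makes them a real basis. -/
theorem IsUnitaryFrame.expansion {e : Fin n → V} (he : IsUnitaryFrame g J e)
    (h : IsHermitianPair g J) (hV : Module.finrank ℝ V = 2 * n) (v : V) :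
    v = ∑ j, g v (e j) • e j + ∑ j, g v (J (e j)) • J (e j) := by
  have hJe : ∀ i j, g (J (e i)) (e j) = 0 := fun i j ↦ by
    rw [h.symm]; exact he.orthogonal j i
  have hJJ : ∀ i j, g (J (e i)) (J (e j)) = if i = j then 1 else 0 := fun i j ↦ by
    rw [h.compat]; exact he.orthonormal i j
  have hli : LinearIndependent ℝ (Sum.elim e (fun j ↦ J (e j))) := by
    rw [Fintype.linearIndependent_iff]
    intro c hc
    simp only [Fintype.sum_sum_type, Sum.elim_inl, Sum.elim_inr] at hc
    rintro (k | k)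
    · have := congrArg (fun w ↦ g w (e k)) hc
      simpa [he.orthonormal, hJe] using this
    · have := congrArg (fun w ↦ g w (J (e k))) hc
      simpa [he.orthogonal, hJJ] using this
  have hspan := hli.span_eq_top_of_card_eq_finrank' (by simp [hV]; ring)
  have hv : v ∈ Submodule.span ℝ (range (Sum.elim e (fun j ↦ J (e j)))) := hspan ▸ trivial
  obtain ⟨c, rfl⟩ := (Submodule.mem_span_range_iff_exists_fun ℝ).1 hv
  simp only [Fintype.sum_sum_type, Sum.elim_inl, Sum.elim_inr]
  simp [he.orthonormal, hJe, he.orthogonal, hJJ]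

theorem IsUnitaryFrame.parseval {e : Fin n → V} (he : IsUnitaryFrame g J e)
    (h : IsHermitianPair g J) (hV : Module.finrank ℝ V = 2 * n) (v : V) :
    g v v = ∑ j, (g v (e j) ^ 2 + g v (J (e j)) ^ 2) := by
  conv_lhs => enter [2]; rw [he.expansion h hV v]
  simp [Finset.sum_add_distrib, sq]

/-- `e` is a unitary frame diagonalizing `η` with diagonal entries `lam`. -/
structure IsDiagonalFrame (g : V →L[ℝ] V →L[ℝ] ℝ) (J : V →L[ℝ] V) (η : V →L[ℝ] V →L[ℝ] ℝ)
    (e : Fin n → V) (lam : Fin n → ℝ) : Prop extends IsUnitaryFrame g J e where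
  isotropic : ∀ i j, η (e i) (e j) = 0
  diagonal : ∀ i j, η (e i) (J (e j)) = if i = j then lam i else 0

/-- `η` is a real `(1,1)`-form for the complex structure `J`. -/
structure IsOneOne (J : V →L[ℝ] V) (η : V →L[ℝ] V →L[ℝ] ℝ) : Prop where
  neg_swap : ∀ v w, η v w = -η w v
  invariant : ∀ v w, η (J v) (J w) = η v w

/-- This is the Hermitian quadratic form of `η` in its eigenbasis; the weights are the squared
moduli of the complex coordinates of `v`. -/
theorem IsDiagonalFrame.apply_J_self {η : V →L[ℝ] V →L[ℝ] ℝ} {e : Fin n → V} {lam : Fin n → ℝ}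
    (he : IsDiagonalFrame g J η e lam) (h : IsHermitianPair g J) (hη : IsOneOne J η)
    (hV : Module.finrank ℝ V = 2 * n) (v : V) :
    η v (J v) = ∑ j, (g v (e j) ^ 2 + g v (J (e j)) ^ 2) * lam j := by
  have h1 : ∀ i j, η (J (e i)) (e j) = -(if j = i then lam j else 0) := fun i j ↦ by
    rw [hη.neg_swap, he.diagonal]
  have h2 : ∀ i j, η (J (e i)) (J (e j)) = 0 := fun i j ↦ by
    rw [hη.invariant, he.isotropic]
  conv_lhs => rw [he.expansion h hV v]
  simp only [map_add, map_sum, map_smul, h.sq, add_apply,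
    sum_apply, smul_apply, smul_neg, map_neg,
    he.isotropic, he.diagonal, h1, h2, smul_eq_mul, mul_zero, Finset.sum_const_zero, mul_ite,
    Finset.sum_ite_eq, Finset.sum_ite_eq', Finset.mem_univ, if_true, mul_neg,
    Finset.sum_neg_distrib, neg_neg, add_zero, zero_add]
  rw [← Finset.sum_add_distrib]
  exact Finset.sum_congr rfl fun j _ ↦ by ring

/-- The entries are the squared moduli of the unitary change-of-frame matrix. Row sums are Parseval
in `e`; column sums are Parseval in `e'`, after the roles of the frames are exchanged. -/
theorem IsUnitaryFrame.mem_doublyStochastic {e e' : Fin n → V} (he : IsUnitaryFrame g J e)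
    (he' : IsUnitaryFrame g J e') (h : IsHermitianPair g J) (hV : Module.finrank ℝ V = 2 * n) :
    (Matrix.of fun i j ↦ g (e' i) (e j) ^ 2 + g (e' i) (J (e j)) ^ 2) ∈
      doublyStochastic ℝ (Fin n) := by
  rw [mem_doublyStochastic_iff_sum]
  refine ⟨fun i j ↦ by simp only [Matrix.of_apply]; positivity, fun i ↦ ?_, fun j ↦ ?_⟩
  · simp only [Matrix.of_apply]
    rw [← he.parseval h hV, he'.orthonormal, if_pos rfl]
  · have : ∀ i, g (e' i) (e j) ^ 2 + g (e' i) (J (e j)) ^ 2 =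
        g (e j) (e' i) ^ 2 + g (e j) (J (e' i)) ^ 2 := fun i ↦ by
      rw [h.symm (e' i) (e j), h.symm (e' i) (J (e j)), h.apply_J_left, neg_sq]
    simp only [Matrix.of_apply, this]
    rw [← he'.parseval h hV, he.orthonormal, if_pos rfl]

end UnitaryFrame

/-! ### Schur–Birkhoff averaging and monotonicity of `f ∘ λ`. -/

section SymmetricFunctions

variable {n : ℕ} {Γ : Set (Fin n → ℝ)} {f : (Fin n → ℝ) → ℝ}

/-- By Birkhoff's theorem `S` is a convex combination of permutation matrices, so `S.mulVec lam` is
a convex combination of permutations of `lam`. Symmetry and convexity of `Γ`, then symmetry and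
Jensen for `f`, finish. -/
theorem IsSymmetricCone.mulVec_mem (hΓ : IsSymmetricCone Γ) (hf : IsEllipticConcave Γ f)
    {S : Matrix (Fin n) (Fin n) ℝ} (hS : S ∈ doublyStochastic ℝ (Fin n)) {lam : Fin n → ℝ}
    (hlam : lam ∈ Γ) : S.mulVec lam ∈ Γ ∧ f lam ≤ f (S.mulVec lam) := by
  obtain ⟨w, hw0, hw1, rfl⟩ := exists_eq_sum_perm_of_mem_doublyStochastic hS
  have hsum : (∑ σ, w σ • σ.permMatrix ℝ).mulVec lam = ∑ σ, w σ • (lam ∘ σ) := by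
    simp only [Matrix.sum_mulVec, Matrix.smul_mulVec, Matrix.permMatrix_mulVec]
  rw [hsum]
  refine ⟨hΓ.convex.sum_mem (fun σ _ ↦ hw0 σ) hw1 fun σ _ ↦ hΓ.symm lam hlam σ, ?_⟩
  calc f lam = ∑ σ, w σ • f (lam ∘ σ) := by
        simp only [hf.symm lam hlam, ← Finset.sum_smul, hw1, one_smul]
    _ ≤ _ := hf.concave.le_map_sum (fun σ _ ↦ hw0 σ) hw1 fun σ _ ↦ hΓ.symm lam hlam σ

theorem IsEllipticConcave.le_of_le (hΓ : IsSymmetricCone Γ) (hf : IsEllipticConcave Γ f)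
    {a b : Fin n → ℝ} (ha : a ∈ Γ) (hb : b ∈ Γ) (hab : a ≤ b) : f a ≤ f b := by
  have hmem : ∀ t ∈ Icc (0 : ℝ) 1, a + t • (b - a) ∈ Γ := fun t ht ↦ by
    have := hΓ.convex ha hb (sub_nonneg.2 ht.2) ht.1 (by ring)
    convert this using 1
    module
  have hder : ∀ t ∈ Icc (0 : ℝ) 1, HasDerivAt (fun t : ℝ ↦ f (a + t • (b - a)))
      (fderiv ℝ f (a + t • (b - a)) (b - a)) t := fun t ht ↦ by
    have hd : DifferentiableAt ℝ f (a + t • (b - a)) :=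
      (hf.smooth.contDiffAt (hΓ.isOpen.mem_nhds (hmem t ht))).differentiableAt (by simp)
    have hl : HasDerivAt (fun t : ℝ ↦ a + t • (b - a)) (b - a) t := by
      simpa using ((hasDerivAt_id t).smul_const (b - a)).const_add a
    exact hd.hasFDerivAt.comp_hasDerivAt t hl
  have hmono : MonotoneOn (fun t : ℝ ↦ f (a + t • (b - a))) (Icc 0 1) := by
    refine monotoneOn_of_deriv_nonneg (convex_Icc 0 1)
      (fun t ht ↦ (hder t ht).continuousAt.continuousWithinAt)
      (fun t ht ↦ (hder t (interior_subset ht)).differentiableAt.differentiableWithinAt)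
      fun t ht ↦ ?_
    rw [(hder t (interior_subset ht)).deriv]
    have : b - a = ∑ i, (b i - a i) • (Pi.single i (1 : ℝ) : Fin n → ℝ) := by
      ext j; simp [Finset.sum_apply, Pi.single_apply]
    rw [this, map_sum]
    refine Finset.sum_nonneg fun i _ ↦ ?_
    rw [map_smul, smul_eq_mul]
    have hp := hmem t (interior_subset ht)
    exact mul_nonneg (sub_nonneg.2 (hab i)) (this ▸ (hf.elliptic _ hp i)).le
  simpa using hmono (left_mem_Icc.2 zero_le_one) (right_mem_Icc.2 zero_le_one) zero_le_one

variable {V : Type*} [AddCommGroup V] [Module ℝ V] [TopologicalSpace V]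
  [FiniteDimensional ℝ V] {g : V →L[ℝ] V →L[ℝ] ℝ} {J : V →L[ℝ] V}

/-- The eigenvalues in one diagonal frame are doubly stochastic averages of those in another. -/
theorem IsDiagonalFrame.mem_cone {η : V →L[ℝ] V →L[ℝ] ℝ} {e e' : Fin n → V}
    {lam lam' : Fin n → ℝ} (hΓ : IsSymmetricCone Γ) (hf : IsEllipticConcave Γ f)
    (h : IsHermitianPair g J) (hV : Module.finrank ℝ V = 2 * n) (hη : IsOneOne J η)
    (he : IsDiagonalFrame g J η e lam) (he' : IsDiagonalFrame g J η e' lam') (hlam : lam ∈ Γ) :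
    lam' ∈ Γ := by
  have hS := he.mem_doublyStochastic he'.toIsUnitaryFrame h hV
  -- Since `e'` also diagonalizes `η`, its diagonal entries are `lam'`, so `lam' = S lam`.
  convert (hΓ.mulVec_mem hf hS hlam).1 using 1
  ext i
  have := he.apply_J_self h hη hV (e' i)
  rw [he'.diagonal, if_pos rfl] at this
  simpa [Matrix.mulVec, dotProduct] using this

/-- Monotonicity of `f ∘ λ` in the Hermitian form. -/
theorem IsDiagonalFrame.map_le_map {η η' : V →L[ℝ] V →L[ℝ] ℝ} {e e' : Fin n → V}
    {lam lam' : Fin n → ℝ} (hΓ : IsSymmetricCone Γ) (hf : IsEllipticConcave Γ f)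
    (h : IsHermitianPair g J) (hV : Module.finrank ℝ V = 2 * n) (hη : IsOneOne J η)
    (he : IsDiagonalFrame g J η e lam) (he' : IsDiagonalFrame g J η' e' lam') (hlam : lam ∈ Γ)
    (hlam' : lam' ∈ Γ) (hle : ∀ v, η v (J v) ≤ η' v (J v)) : f lam ≤ f lam' := by
  have hS := he.mem_doublyStochastic he'.toIsUnitaryFrame h hV
  obtain ⟨hmem, hfle⟩ := hΓ.mulVec_mem hf hS hlam
  -- `S lam` is the diagonal of `η` in the eigenframe of `η'`, hence entrywise at most `lam'`; no
  -- min-max principle is required.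
  refine hfle.trans (hf.le_of_le hΓ hmem hlam' fun i ↦ ?_)
  have h1 := he.apply_J_self h hη hV (e' i)
  have h2 := hle (e' i)
  rw [he'.diagonal, if_pos rfl, h1] at h2
  simpa [Matrix.mulVec, dotProduct] using h2

end SymmetricFunctions

/-- Restrict to the line through `y` in direction `v`. A positive second derivative would make the
local maximum a local minimum as well, so the function would be locally constant, with zero second
derivative. -/
theorem IsLocalMax.fderiv_fderiv_nonpos {E : Type*} [NormedAddCommGroup E] [NormedSpace ℝ E]
    {φ : E → ℝ} {y : E} (hmax : IsLocalMax φ y) (hφ : ContDiffAt ℝ 2 φ y) (v : E) :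
    fderiv ℝ (fderiv ℝ φ) y v v ≤ 0 := by
  have hline : ∀ t : ℝ, HasDerivAt (fun t : ℝ ↦ y + t • v) v t := fun t ↦ by
    simpa using ((hasDerivAt_id t).smul_const v).const_add y
  have hcont : Tendsto (fun t : ℝ ↦ y + t • v) (𝓝 0) (𝓝 y) := by
    simpa using (hline 0).continuousAt.tendsto
  have hd : ∀ᶠ z in 𝓝 y, DifferentiableAt ℝ φ z :=
    (hφ.eventually (by simp)).mono fun z hz ↦ hz.differentiableAt (by simp)
  have h1 : deriv (fun t : ℝ ↦ φ (y + t • v)) =ᶠ[𝓝 0] fun t ↦ fderiv ℝ φ (y + t • v) v := by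
    filter_upwards [hcont.eventually hd] with t ht
    exact (ht.hasFDerivAt.comp_hasDerivAt t (hline t)).deriv
  have h2 : deriv (deriv fun t : ℝ ↦ φ (y + t • v)) 0 = fderiv ℝ (fderiv ℝ φ) y v v := by
    rw [h1.deriv_eq]
    have hdd : DifferentiableAt ℝ (fderiv ℝ φ) y :=
      (hφ.fderiv_right (m := 1) (by norm_num [one_add_one_eq_two])).differentiableAt (by simp)
    have hF : HasFDerivAt (fun z ↦ fderiv ℝ φ z v) ((fderiv ℝ (fderiv ℝ φ) y).flip v) y :=
      by simpa using hdd.hasFDerivAt.clm_apply (hasFDerivAt_const v y)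
    exact (hF.comp_hasDerivAt_of_eq (0 : ℝ) (hline 0) (by simp)).deriv
  have hmax0 : IsLocalMax (fun t : ℝ ↦ φ (y + t • v)) 0 := by
    have := hcont.eventually hmax
    simpa [IsLocalMax, IsMaxFilter] using this
  by_contra! hpos
  rw [← h2] at hpos
  have hc : ContinuousAt (fun t : ℝ ↦ φ (y + t • v)) 0 := by
    refine ContinuousAt.comp' (f := fun t : ℝ ↦ y + t • v) ?_ (hline 0).continuousAt
    simpa using hφ.continuousAt
  have hmin := isLocalMin_of_deriv_deriv_pos hpos hmax0.deriv_eq_zero hc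
  have hconst : (fun t : ℝ ↦ φ (y + t • v)) =ᶠ[𝓝 0] fun _ ↦ φ (y + (0 : ℝ) • v) := by
    filter_upwards [hmin, hmax0] with t ht ht'
    exact le_antisymm ht' ht
  have := hconst.deriv.deriv_eq
  simp only [deriv_const', deriv_const] at this
  exact hpos.ne' this

/-! ### The form `√-1 ∂∂̄ u` in the chart centred at an interior point. -/

section Chart

variable {E : Type*} [NormedAddCommGroup E] [NormedSpace ℝ E]
    {H : Type*} [TopologicalSpace H] {I : ModelWithCorners ℝ E H}
    {M : Type*} [TopologicalSpace M] [ChartedSpace H M]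

theorem ModelWithCorners.IsInteriorPoint.range_mem_nhds {p : M} (hp : I.IsInteriorPoint p) :
    range I ∈ 𝓝 (extChartAt I p p) := mem_interior_iff_mem_nhds.1 hp

theorem ModelWithCorners.IsInteriorPoint.target_mem_nhds {p : M} (hp : I.IsInteriorPoint p) :
    (extChartAt I p).target ∈ 𝓝 (extChartAt I p p) := by
  have := extChartAt_target_mem_nhdsWithin (I := I) p
  rwa [nhdsWithin_eq_nhds.2 hp.range_mem_nhds] at this

theorem ModelWithCorners.IsInteriorPoint.tendsto_symm {p : M} (_ : I.IsInteriorPoint p) :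
    Tendsto (extChartAt I p).symm (𝓝 (extChartAt I p p)) (𝓝 p) := by
  have := continuousAt_extChartAt_symm (I := I) p
  rwa [ContinuousAt, extChartAt_to_inv] at this

theorem ModelWithCorners.IsInteriorPoint.eventually_nhds {p : M} (hp : I.IsInteriorPoint p) :
    ∀ᶠ y in 𝓝 (extChartAt I p p), y ∈ (extChartAt I p).target ∧ range I ∈ 𝓝 y :=
  (show ∀ᶠ y in 𝓝 (extChartAt I p p), y ∈ (extChartAt I p).target from hp.target_mem_nhds).and
    (eventually_mem_nhds_iff.2 hp.range_mem_nhds)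

theorem ContMDiffAt.contDiffAt_comp_extChartAt_symm {F : Type*} [NormedAddCommGroup F]
    [NormedSpace ℝ F] {k : ℕ∞} {u : M → F} {p : M} (hu : ContMDiffAt I 𝓘(ℝ, F) k u p)
    (hp : I.IsInteriorPoint p) : ContDiffAt ℝ k (u ∘ (extChartAt I p).symm) (extChartAt I p p) := by
  have h := (contMDiffAt_iff.1 hu).2
  simpa only [extChartAt_model_space_eq_id, PartialEquiv.refl_coe, Function.id_comp] using
    h.contDiffAt hp.range_mem_nhds

variable [IsManifold I ∞ M]

/-- The complex structure in the chart centred at `p`. -/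
noncomputable def ComplexStructure.inChart (𝒥 : ComplexStructure I M) (p : M) (y : E) : E →L[ℝ] E :=
  ((mfderiv I 𝓘(ℝ, E) (extChartAt I p) ((extChartAt I p).symm y) :
      TangentSpace I ((extChartAt I p).symm y) →L[ℝ] E).comp
    (𝒥.J ((extChartAt I p).symm y))).comp
    (mfderivWithin 𝓘(ℝ, E) I (extChartAt I p).symm (range I) y)

/-- The `1`-form `du ∘ J`. -/
noncomputable def ComplexStructure.dForm (𝒥 : ComplexStructure I M) (u : M → ℝ) (x : M) :
    TangentSpace I x →L[ℝ] ℝ :=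
  (mfderiv I 𝓘(ℝ, ℝ) u x : TangentSpace I x →L[ℝ] ℝ).comp (𝒥.J x)

theorem ComplexStructure.contDiffAt_inChart (𝒥 : ComplexStructure I M) {p : M}
    (hp : I.IsInteriorPoint p) : ContDiffAt ℝ ∞ (𝒥.inChart p) (extChartAt I p p) := by
  have h1 := ((contMDiffAt_hom_bundle _).1 (𝒥.smooth p)).2
  have h2 := ContMDiffAt.contDiffAt_comp_extChartAt_symm (k := ⊤) h1 hp
  refine h2.congr_of_eventuallyEq ?_
  filter_upwards [hp.eventually_nhds] with y hy
  have hs := (extChartAt I p).map_target hy.1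
  rw [extChartAt_source] at hs
  simp only [Function.comp_apply, ContinuousLinearMap.inCoordinates]
  rw [TangentBundle.continuousLinearMapAt_trivializationAt hs,
    TangentBundle.symmL_trivializationAt hs, (extChartAt I p).right_inv hy.1]
  rfl

theorem fderiv_comp_extChartAt_symm {F : Type*} [NormedAddCommGroup F] [NormedSpace ℝ F]
    {u : M → F} {p : M} {y : E}
    (hy : y ∈ (extChartAt I p).target) (hr : range I ∈ 𝓝 y)
    (hu : MDifferentiableAt I 𝓘(ℝ, F) u ((extChartAt I p).symm y)) :
    fderiv ℝ (u ∘ (extChartAt I p).symm) y =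
      (mfderiv I 𝓘(ℝ, F) u ((extChartAt I p).symm y) :
        TangentSpace I ((extChartAt I p).symm y) →L[ℝ] F).comp
      (mfderivWithin 𝓘(ℝ, E) I (extChartAt I p).symm (range I) y) := by
  have hs := mdifferentiableWithinAt_extChartAt_symm (I := I) hy
  rw [← mfderiv_eq_fderiv, ← mfderivWithin_eq_mfderiv (s := range I)
    (I.uniqueMDiffOn y (extChartAt_target_subset_range p hy))]
  · exact mfderiv_comp_mfderivWithin y hu hs
      (I.uniqueMDiffOn y (extChartAt_target_subset_range p hy))
  · exact hu.comp y (hs.mdifferentiableAt hr)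

theorem ComplexStructure.oneFormInChart_dForm (𝒥 : ComplexStructure I M) {u : M → ℝ} {p : M} {y : E}
    (hy : y ∈ (extChartAt I p).target) (hr : range I ∈ 𝓝 y)
    (hu : MDifferentiableAt I 𝓘(ℝ, ℝ) u ((extChartAt I p).symm y)) :
    oneFormInChart I (𝒥.dForm u) p y =
      (fderiv ℝ (u ∘ (extChartAt I p).symm) y).comp (𝒥.inChart p y) := by
  rw [fderiv_comp_extChartAt_symm hy hr hu]
  have h := mfderivWithin_extChartAt_symm_comp_mfderiv_extChartAt (I := I) hy
  ext v
  have h' := congrArg (fun L ↦ L (𝒥.J ((extChartAt I p).symm y)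
    (mfderivWithin 𝓘(ℝ, E) I (extChartAt I p).symm (range I) y v))) h
  exact (congrArg (mfderiv I 𝓘(ℝ, ℝ) u ((extChartAt I p).symm y)) h').symm

variable {u : M → ℝ} {p : M}

theorem ComplexStructure.oneFormInChart_dForm_eventuallyEq (𝒥 : ComplexStructure I M)
    (hu : ContMDiff I 𝓘(ℝ, ℝ) 2 u) (hp : I.IsInteriorPoint p) :
    oneFormInChart I (𝒥.dForm u) p =ᶠ[𝓝 (extChartAt I p p)]
      fun y ↦ (fderiv ℝ (u ∘ (extChartAt I p).symm) y).comp (𝒥.inChart p y) := by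
  filter_upwards [hp.eventually_nhds] with y hy
  exact 𝒥.oneFormInChart_dForm hy.1 hy.2 (hu.mdifferentiable (by simp) _)

theorem ComplexStructure.contDiffAt_oneFormInChart_dForm (𝒥 : ComplexStructure I M)
    (hu : ContMDiff I 𝓘(ℝ, ℝ) 2 u) (hp : I.IsInteriorPoint p) :
    ContDiffAt ℝ 1 (oneFormInChart I (𝒥.dForm u) p) (extChartAt I p p) := by
  refine ContDiffAt.congr_of_eventuallyEq ?_ (𝒥.oneFormInChart_dForm_eventuallyEq hu hp)
  have h1 := ContMDiffAt.contDiffAt_comp_extChartAt_symm (k := 2) (hu p) hp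
  exact (h1.fderiv_right (m := 1) (by norm_num [one_add_one_eq_two])).clm_comp
    ((𝒥.contDiffAt_inChart hp).of_le (by simp))

theorem ComplexStructure.fderiv_oneFormInChart_dForm (𝒥 : ComplexStructure I M)
    (hu : ContMDiff I 𝓘(ℝ, ℝ) 2 u) (hp : I.IsInteriorPoint p) (v w : E) :
    fderiv ℝ (oneFormInChart I (𝒥.dForm u) p) (extChartAt I p p) v w =
      fderiv ℝ (fderiv ℝ (u ∘ (extChartAt I p).symm)) (extChartAt I p p) v
          (𝒥.inChart p (extChartAt I p p) w) +
        fderiv ℝ (u ∘ (extChartAt I p).symm) (extChartAt I p p)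
          (fderiv ℝ (𝒥.inChart p) (extChartAt I p p) v w) := by
  have h1 := ContMDiffAt.contDiffAt_comp_extChartAt_symm (k := 2) (hu p) hp
  have h2 : DifferentiableAt ℝ (fderiv ℝ (u ∘ (extChartAt I p).symm)) (extChartAt I p p) :=
    (h1.fderiv_right (m := 1) (by norm_num [one_add_one_eq_two])).differentiableAt (by simp)
  have h3 := (𝒥.contDiffAt_inChart hp).differentiableAt (by simp)
  rw [(𝒥.oneFormInChart_dForm_eventuallyEq hu hp).fderiv_eq,
    (h2.hasFDerivAt.clm_comp h3.hasFDerivAt).fderiv]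
  simp [add_comm]

theorem extDerivOneForm_apply_of_isInteriorPoint (hp : I.IsInteriorPoint p)
    (α : ∀ x : M, TangentSpace I x →L[ℝ] ℝ) (v w : TangentSpace I p) :
    extDerivOneForm I α p v w =
      fderiv ℝ (oneFormInChart I α p) (extChartAt I p p) v w -
        fderiv ℝ (oneFormInChart I α p) (extChartAt I p p) w v := by
  -- The tangent space at `p` is modelled on `E` through this very chart, so the chart's derivative
  -- at its own centre is the identity.
  have hD : (mfderiv I 𝓘(ℝ, E) (extChartAt I p) p : TangentSpace I p →L[ℝ] E) =
    ContinuousLinearMap.id ℝ E := mfderiv_extChartAt_self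
  unfold extDerivOneForm
  rw [fderivWithin_of_mem_nhds hp.range_mem_nhds]
  simp only [hD]
  rfl

theorem ddbar_apply_of_isInteriorPoint (𝒥 : ComplexStructure I M)
    (hp : I.IsInteriorPoint p) (v w : TangentSpace I p) :
    ddbar 𝒥 u p v w = -(1 / 2) *
      (fderiv ℝ (oneFormInChart I (𝒥.dForm u) p) (extChartAt I p p) v w -
        fderiv ℝ (oneFormInChart I (𝒥.dForm u) p) (extChartAt I p p) w v) := by
  rw [← extDerivOneForm_apply_of_isInteriorPoint hp]
  rfl

theorem ComplexStructure.inChart_extChartAt (𝒥 : ComplexStructure I M) {x : M}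
    (hx : x ∈ (extChartAt I p).source) (v : E) :
    𝒥.inChart p (extChartAt I p x) v = (mfderiv I 𝓘(ℝ, E) (extChartAt I p) x :
      TangentSpace I x →L[ℝ] E) (𝒥.J x
        (mfderivWithin 𝓘(ℝ, E) I (extChartAt I p).symm (range I) (extChartAt I p x) v)) := by
  have h := congrArg (β := E →L[ℝ] E) (fun z ↦ (mfderiv I 𝓘(ℝ, E) (extChartAt I p) z :
    TangentSpace I z →L[ℝ] E).comp (𝒥.J z)) ((extChartAt I p).left_inv hx)
  exact congrArg (fun L : E →L[ℝ] E ↦ L (mfderivWithin 𝓘(ℝ, E) I (extChartAt I p).symm (range I)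
    (extChartAt I p x) v)) h

theorem ComplexStructure.inChart_self (𝒥 : ComplexStructure I M) (p : M) (v : TangentSpace I p) :
    𝒥.inChart p (extChartAt I p p) v = 𝒥.J p v := by
  refine (𝒥.inChart_extChartAt (mem_extChartAt_source p) v).trans ?_
  have h1 := mfderivWithin_range_extChartAt_symm (I := I) (x := p)
  have h2 := mfderiv_extChartAt_self (I := I) (x := p)
  have h1' := congrArg (fun L : E →L[ℝ] E ↦ L v) h1
  have h2' := congrArg (fun L : E →L[ℝ] E ↦ L (𝒥.J p v)) h2
  exact (congrArg (fun z ↦ mfderiv I 𝓘(ℝ, E) (extChartAt I p) p (𝒥.J p z)) h1').trans h2'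

theorem ComplexStructure.inChart_inChart (𝒥 : ComplexStructure I M) {y : E}
    (hy : y ∈ (extChartAt I p).target) (v : E) :
    𝒥.inChart p y (𝒥.inChart p y v) = -v := by
  obtain ⟨x, hx, rfl⟩ : ∃ x ∈ (extChartAt I p).source, extChartAt I p x = y :=
    ⟨_, (extChartAt I p).map_target hy, (extChartAt I p).right_inv hy⟩
  rw [𝒥.inChart_extChartAt hx, 𝒥.inChart_extChartAt hx]
  have h1 := congrArg (fun L : E →L[ℝ] E ↦ L v)
    (mfderiv_extChartAt_comp_mfderivWithin_extChartAt_symm' (I := I) hx)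
  have h2 := congrArg (fun L ↦ L (𝒥.J x
    (mfderivWithin 𝓘(ℝ, E) I (extChartAt I p).symm (range I) (extChartAt I p x) v)))
    (mfderivWithin_extChartAt_symm_comp_mfderiv_extChartAt' (I := I) hx)
  refine (congrArg (fun z ↦ mfderiv I 𝓘(ℝ, E) (extChartAt I p) x (𝒥.J x z)) h2).trans ?_
  refine (congrArg (mfderiv I 𝓘(ℝ, E) (extChartAt I p) x) (𝒥.sq x _)).trans ?_
  refine (ContinuousLinearMap.map_neg _ _).trans ?_
  exact congrArg Neg.neg h1

/-- At an interior maximum of `u₁ - u₂` the forms `√-1 ∂∂̄ u₁` and `√-1 ∂∂̄ u₂` are ordered. -/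
theorem ddbar_apply_J_le_of_isMaxOn (𝒥 : ComplexStructure I M) {u₁ u₂ : M → ℝ}
    (h₁ : ContMDiff I 𝓘(ℝ, ℝ) 2 u₁) (h₂ : ContMDiff I 𝓘(ℝ, ℝ) 2 u₂) (hp : I.IsInteriorPoint p)
    (hmax : ∀ x, u₁ x - u₂ x ≤ u₁ p - u₂ p) (v : TangentSpace I p) :
    ddbar 𝒥 u₁ p v (𝒥.J p v) ≤ ddbar 𝒥 u₂ p v (𝒥.J p v) := by
  set y := extChartAt I p p with hy
  have hc₁ := ContMDiffAt.contDiffAt_comp_extChartAt_symm (k := 2) (h₁ p) hp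
  have hc₂ := ContMDiffAt.contDiffAt_comp_extChartAt_symm (k := 2) (h₂ p) hp
  rw [← hy] at hc₁ hc₂
  have hloc : IsLocalMax
      (u₁ ∘ (extChartAt I p).symm - u₂ ∘ (extChartAt I p).symm) y :=
    Eventually.of_forall fun z ↦ by simpa [hy] using hmax _
  have hd₁ : ∀ᶠ z in 𝓝 y, DifferentiableAt ℝ (u₁ ∘ (extChartAt I p).symm) z :=
    (hc₁.eventually (by simp)).mono fun z hz ↦ hz.differentiableAt (by simp)
  have hd₂ : ∀ᶠ z in 𝓝 y, DifferentiableAt ℝ (u₂ ∘ (extChartAt I p).symm) z :=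
    (hc₂.eventually (by simp)).mono fun z hz ↦ hz.differentiableAt (by simp)
  have hdd₁ : DifferentiableAt ℝ (fderiv ℝ (u₁ ∘ (extChartAt I p).symm)) y :=
    (hc₁.fderiv_right (m := 1) (by norm_num [one_add_one_eq_two])).differentiableAt (by simp)
  have hdd₂ : DifferentiableAt ℝ (fderiv ℝ (u₂ ∘ (extChartAt I p).symm)) y :=
    (hc₂.fderiv_right (m := 1) (by norm_num [one_add_one_eq_two])).differentiableAt (by simp)
  -- The first-order terms of `ddbar`, produced by the derivative of `J` in the chart, agree for
  -- `u₁` and `u₂` because their differentials agree at the maximum.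
  have hfd : fderiv ℝ (u₁ ∘ (extChartAt I p).symm) y = fderiv ℝ (u₂ ∘ (extChartAt I p).symm) y := by
    have := hloc.fderiv_eq_zero
    rw [fderiv_sub hd₁.self_of_nhds hd₂.self_of_nhds] at this
    exact sub_eq_zero.1 this
  have hsnd : ∀ a : E, fderiv ℝ (fderiv ℝ (u₁ ∘ (extChartAt I p).symm)) y a a ≤
      fderiv ℝ (fderiv ℝ (u₂ ∘ (extChartAt I p).symm)) y a a := fun a ↦ by
    have h := hloc.fderiv_fderiv_nonpos (hc₁.sub hc₂) a
    have he : fderiv ℝ (u₁ ∘ (extChartAt I p).symm - u₂ ∘ (extChartAt I p).symm) =ᶠ[𝓝 y]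
        fderiv ℝ (u₁ ∘ (extChartAt I p).symm) - fderiv ℝ (u₂ ∘ (extChartAt I p).symm) := by
      filter_upwards [hd₁, hd₂] with z hz₁ hz₂
      exact fderiv_sub hz₁ hz₂
    rw [he.fderiv_eq, fderiv_sub hdd₁ hdd₂] at h
    exact sub_nonpos.1 h
  have hformula : ∀ u : M → ℝ, ContMDiff I 𝓘(ℝ, ℝ) 2 u → ddbar 𝒥 u p v (𝒥.J p v) = -(1 / 2) *
      (-fderiv ℝ (fderiv ℝ (u ∘ (extChartAt I p).symm)) y v v +
        fderiv ℝ (u ∘ (extChartAt I p).symm) y (fderiv ℝ (𝒥.inChart p) y v (𝒥.J p v)) -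
        (fderiv ℝ (fderiv ℝ (u ∘ (extChartAt I p).symm)) y (𝒥.J p v) (𝒥.J p v) +
        fderiv ℝ (u ∘ (extChartAt I p).symm) y (fderiv ℝ (𝒥.inChart p) y (𝒥.J p v) v))) :=
    fun u hu ↦ by
    -- With `b = K a` and `K b = -a`, the second-order part becomes half the sum of the Hessian on
    -- `a` and on `b`.
    have key : ∀ a b : E, 𝒥.inChart p y a = b → 𝒥.inChart p y b = -a → -(1 / 2) *
        (fderiv ℝ (oneFormInChart I (𝒥.dForm u) p) y a b -
          fderiv ℝ (oneFormInChart I (𝒥.dForm u) p) y b a) = -(1 / 2) *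
        (-fderiv ℝ (fderiv ℝ (u ∘ (extChartAt I p).symm)) y a a +
          fderiv ℝ (u ∘ (extChartAt I p).symm) y (fderiv ℝ (𝒥.inChart p) y a b) -
          (fderiv ℝ (fderiv ℝ (u ∘ (extChartAt I p).symm)) y b b +
          fderiv ℝ (u ∘ (extChartAt I p).symm) y (fderiv ℝ (𝒥.inChart p) y b a))) := by
      intro a b hab hba
      rw [hy, 𝒥.fderiv_oneFormInChart_dForm hu hp, 𝒥.fderiv_oneFormInChart_dForm hu hp, ← hy, hab,
        hba, map_neg]
    exact (ddbar_apply_of_isInteriorPoint 𝒥 hp v (𝒥.J p v)).trans (key v (𝒥.J p v)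
      (𝒥.inChart_self p v) ((𝒥.inChart_self p (𝒥.J p v)).trans (𝒥.sq p v)))
  rw [hformula u₁ h₁, hformula u₂ h₂, hfd]
  have a1 := hsnd v
  have a2 := hsnd (𝒥.J p v)
  linarith

end Chart

/-! ### Integrability of `J` and the type of `√-1 ∂∂̄ u`. -/

section Nijenhuis

variable {E : Type*} [NormedAddCommGroup E] [NormedSpace ℝ E]
    {H : Type*} [TopologicalSpace H] {I : ModelWithCorners ℝ E H}
    {M : Type*} [TopologicalSpace M] [ChartedSpace H M] [IsManifold I ∞ M] {p : M}

theorem ModelWithCorners.IsInteriorPoint.mlieBracket_eq_lieBracket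
    (hp : I.IsInteriorPoint p)
    {V W : ∀ x : M, TangentSpace I x} {V' W' : E → E}
    (hV : ∀ᶠ z in 𝓝 (extChartAt I p p), V ((extChartAt I p).symm z) =
      mfderivWithin 𝓘(ℝ, E) I (extChartAt I p).symm (range I) z (V' z))
    (hW : ∀ᶠ z in 𝓝 (extChartAt I p p), W ((extChartAt I p).symm z) =
      mfderivWithin 𝓘(ℝ, E) I (extChartAt I p).symm (range I) z (W' z)) :
    VectorField.mlieBracket I V W p = VectorField.lieBracket ℝ V' W' (extChartAt I p p) := by
  have pull : ∀ {V : ∀ x : M, TangentSpace I x} {V' : E → E},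
      (∀ᶠ z in 𝓝 (extChartAt I p p), V ((extChartAt I p).symm z) =
        mfderivWithin 𝓘(ℝ, E) I (extChartAt I p).symm (range I) z (V' z)) →
      VectorField.mpullbackWithin 𝓘(ℝ, E) I (extChartAt I p).symm V (range I)
        =ᶠ[𝓝 (extChartAt I p p)] V' := by
    intro V V' hV
    filter_upwards [hV, hp.eventually_nhds] with z hz hzt
    rw [VectorField.mpullbackWithin_apply, hz]
    have hinv := isInvertible_mfderivWithin_extChartAt_symm (I := I) hzt.1
    exact hinv.inverse_apply_eq.2 rfl
  rw [← VectorField.mlieBracketWithin_univ, VectorField.mlieBracketWithin_apply, preimage_univ,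
    univ_inter]
  have h1 : (mfderiv I 𝓘(ℝ, E) (extChartAt I p) p).inverse = ContinuousLinearMap.id ℝ E := by
    rw [mfderiv_extChartAt_self]
    exact ContinuousLinearMap.inverse_id
  have h2 := VectorField.lieBracketWithin_of_mem_nhds (𝕜 := ℝ)
    (V := VectorField.mpullbackWithin 𝓘(ℝ, E) I (extChartAt I p).symm V (range I))
    (W := VectorField.mpullbackWithin 𝓘(ℝ, E) I (extChartAt I p).symm W (range I))
    hp.range_mem_nhds
  have h3 := (pull hV).lieBracket_vectorField_eq (pull hW) (𝕜 := ℝ)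
  exact (congrArg (fun L : E →L[ℝ] E ↦ L _) h1).trans (h2.trans h3)

/-- Integrability is stated for global smooth fields; a bump function extends coordinate-constant
fields so that it can be tested pointwise. -/
theorem exists_contMDiff_vectorField_eventually_const [FiniteDimensional ℝ E] [T2Space M]
    (hp : I.IsInteriorPoint p) (a : E) :
    ∃ X : ∀ x : M, TangentSpace I x,
      ContMDiff I I.tangent ∞ (fun x ↦ (⟨x, X x⟩ : TangentBundle I M)) ∧
      ∀ᶠ z in 𝓝 (extChartAt I p p), X ((extChartAt I p).symm z) =
        mfderivWithin 𝓘(ℝ, E) I (extChartAt I p).symm (range I) z a := by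
  set t := trivializationAt E (TangentSpace I : M → Type _) p
  obtain ⟨f⟩ : Nonempty (SmoothBumpFunction I p) := inferInstance
  refine ⟨fun x ↦ f x • t.symmL ℝ x a, ?_, ?_⟩
  · have hs : ContMDiffOn I I.tangent ∞
        (fun x ↦ (⟨x, t.symmL ℝ x a⟩ : TangentBundle I M)) t.baseSet := by
      intro x hx
      rw [t.contMDiffWithinAt_section _ hx]
      have : ContMDiffOn I 𝓘(ℝ, E) ∞ (fun _ : M ↦ a) t.baseSet := contMDiffOn_const
      refine (this.congr fun y hy ↦ ?_) x hx
      simp [hy]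
    refine ContMDiffOn.smul_section_of_tsupport f.contMDiff.contMDiffOn t.open_baseSet
      ?_ hs
    exact f.tsupport_subset_chartAt_source
  · have hf := hp.tendsto_symm.eventually f.eventuallyEq_one
    filter_upwards [hf, hp.eventually_nhds] with z hz hzt
    have hs := (extChartAt I p).map_target hzt.1
    rw [extChartAt_source] at hs
    simp only [hz, Pi.one_apply, one_smul, t]
    rw [TangentBundle.symmL_trivializationAt hs, (extChartAt I p).right_inv hzt.1]
    rfl

/-- On coordinate-constant fields, the only bracket terms left come from differentiating `K`. -/
theorem ComplexStructure.nijenhuis_inChart [FiniteDimensional ℝ E] [T2Space M]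
    (𝒥 : ComplexStructure I M) (hp : I.IsInteriorPoint p) (a b : E) :
    letI K := 𝒥.inChart p
    letI y := extChartAt I p p
    fderiv ℝ K y (K y a) b - fderiv ℝ K y (K y b) a + K y (fderiv ℝ K y b a)
      - K y (fderiv ℝ K y a b) = 0 := by
  obtain ⟨X, hX, hXa⟩ := exists_contMDiff_vectorField_eventually_const hp a
  obtain ⟨Y, hY, hYb⟩ := exists_contMDiff_vectorField_eventually_const hp b
  have hN := 𝒥.integrable X Y hX hY p
  have hJ : ∀ {X : ∀ x : M, TangentSpace I x} {a : E},
      (∀ᶠ z in 𝓝 (extChartAt I p p), X ((extChartAt I p).symm z) =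
        mfderivWithin 𝓘(ℝ, E) I (extChartAt I p).symm (range I) z a) →
      ∀ᶠ z in 𝓝 (extChartAt I p p), 𝒥.J ((extChartAt I p).symm z) (X ((extChartAt I p).symm z)) =
        mfderivWithin 𝓘(ℝ, E) I (extChartAt I p).symm (range I) z (𝒥.inChart p z a) := by
    intro X a hX
    filter_upwards [hX, hp.eventually_nhds] with z hz hzt
    rw [hz]
    exact (congrArg (fun L ↦ L (𝒥.J ((extChartAt I p).symm z)
      (mfderivWithin 𝓘(ℝ, E) I (extChartAt I p).symm (range I) z a)))
      (mfderivWithin_extChartAt_symm_comp_mfderiv_extChartAt (I := I) hzt.1)).symm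
  have e1 := hp.mlieBracket_eq_lieBracket
    (V := fun z ↦ 𝒥.J z (X z)) (W := fun z ↦ 𝒥.J z (Y z)) (V' := fun z ↦ 𝒥.inChart p z a)
    (W' := fun z ↦ 𝒥.inChart p z b) (hJ hXa) (hJ hYb)
  have e2 := hp.mlieBracket_eq_lieBracket
    (V := fun z ↦ 𝒥.J z (X z)) (V' := fun z ↦ 𝒥.inChart p z a) (hJ hXa) (W' := fun _ ↦ b) hYb
  have e3 := hp.mlieBracket_eq_lieBracket (V' := fun _ ↦ a)
    (W := fun z ↦ 𝒥.J z (Y z)) (W' := fun z ↦ 𝒥.inChart p z b) hXa (hJ hYb)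
  have e4 := hp.mlieBracket_eq_lieBracket (V' := fun _ ↦ a) (W' := fun _ ↦ b) hXa hYb
  have hK : DifferentiableAt ℝ (𝒥.inChart p) (extChartAt I p p) :=
    (𝒥.contDiffAt_inChart hp).differentiableAt (by simp)
  have hKd : ∀ c d : E, fderiv ℝ (fun z ↦ 𝒥.inChart p z c) (extChartAt I p p) d =
      fderiv ℝ (𝒥.inChart p) (extChartAt I p p) d c := fun c d ↦ by
    have h : HasFDerivAt (fun z ↦ 𝒥.inChart p z c)
        ((fderiv ℝ (𝒥.inChart p) (extChartAt I p p)).flip c) (extChartAt I p p) := by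
      simpa using hK.hasFDerivAt.clm_apply (hasFDerivAt_const c (extChartAt I p p))
    rw [h.fderiv]; rfl
  simp only [VectorField.lieBracket, hKd, fderiv_fun_const, Pi.zero_apply, zero_apply,
    sub_zero, zero_sub] at e1 e2 e3 e4
  rw [e1, e2, e3, e4] at hN
  have i2 : 𝒥.J p (-fderiv ℝ (𝒥.inChart p) (extChartAt I p p) b a) =
      -𝒥.inChart p (extChartAt I p p) (fderiv ℝ (𝒥.inChart p) (extChartAt I p p) b a) :=
    (𝒥.inChart_self p _).symm.trans (ContinuousLinearMap.map_neg _ _)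
  have i3 := 𝒥.inChart_self p (fderiv ℝ (𝒥.inChart p) (extChartAt I p p) a b)
  have hN' : ∀ (A B C : E), A - B - C - 0 = 0 → A - B - C = 0 := fun A B C h ↦ by simpa using h
  have := hN' _ _ _ hN
  erw [i2, ← i3] at this
  simpa [sub_eq_add_neg] using this

/-- Differentiate `K² = -1`. -/
theorem ComplexStructure.fderiv_inChart_anticomm (𝒥 : ComplexStructure I M)
    (hp : I.IsInteriorPoint p) (a b : E) :
    letI K := 𝒥.inChart p
    letI y := extChartAt I p p
    fderiv ℝ K y a (K y b) = -K y (fderiv ℝ K y a b) := by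
  have hK := ((𝒥.contDiffAt_inChart hp).differentiableAt (by simp)).hasFDerivAt
  have h1 := (hK.clm_comp hK).fderiv
  have h2 : (fun z ↦ (𝒥.inChart p z).comp (𝒥.inChart p z)) =ᶠ[𝓝 (extChartAt I p p)]
      fun _ ↦ -ContinuousLinearMap.id ℝ E := by
    filter_upwards [hp.eventually_nhds] with z hz
    ext v
    exact 𝒥.inChart_inChart hz.1 v
  rw [h2.fderiv_eq] at h1
  have h3 := congrArg (fun L ↦ L a b) h1
  simp only [fderiv_fun_const, Pi.zero_apply] at h3
  have h4 : 𝒥.inChart p (extChartAt I p p) (fderiv ℝ (𝒥.inChart p) (extChartAt I p p) a b) +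
      fderiv ℝ (𝒥.inChart p) (extChartAt I p p) a (𝒥.inChart p (extChartAt I p p) b) = 0 := by
    simpa using h3.symm
  exact eq_neg_of_add_eq_zero_right h4

theorem isOneOne_ddbar [FiniteDimensional ℝ E] [T2Space M] (𝒥 : ComplexStructure I M)
    {u : M → ℝ} (hu : ContMDiff I 𝓘(ℝ, ℝ) 2 u) (hp : I.IsInteriorPoint p) :
    IsOneOne (𝒥.J p) (ddbar 𝒥 u p) := by
  refine ⟨fun v w ↦ ?_, fun v w ↦ ?_⟩
  · rw [ddbar_apply_of_isInteriorPoint 𝒥 hp, ddbar_apply_of_isInteriorPoint 𝒥 hp]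
    ring
  · have key : ∀ a b a' b' : E, 𝒥.inChart p (extChartAt I p p) a = a' →
        𝒥.inChart p (extChartAt I p p) b = b' →
        -(1 / 2) * (fderiv ℝ (oneFormInChart I (𝒥.dForm u) p) (extChartAt I p p) a' b' -
          fderiv ℝ (oneFormInChart I (𝒥.dForm u) p) (extChartAt I p p) b' a') =
        -(1 / 2) * (fderiv ℝ (oneFormInChart I (𝒥.dForm u) p) (extChartAt I p p) a b -
          fderiv ℝ (oneFormInChart I (𝒥.dForm u) p) (extChartAt I p p) b a) := by
      rintro a b _ _ rfl rfl
      have hc := ContMDiffAt.contDiffAt_comp_extChartAt_symm (k := 2) (hu p) hp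
      have hsymm : IsSymmSndFDerivAt ℝ (u ∘ (extChartAt I p).symm) (extChartAt I p p) :=
        hc.isSymmSndFDerivAt (by simp)
      have hK := 𝒥.inChart_inChart hp.eventually_nhds.self_of_nhds.1
      -- Applying `du ∘ K` to the Nijenhuis identity cancels the first-order terms; symmetry of the
      -- Hessian cancels the second-order ones.
      have hN := congrArg (fun z ↦ fderiv ℝ (u ∘ (extChartAt I p).symm) (extChartAt I p p)
        (𝒥.inChart p (extChartAt I p p) z)) (𝒥.nijenhuis_inChart hp a b)
      simp only [map_sub, map_add, map_zero, hK, map_neg] at hN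
      simp only [𝒥.fderiv_oneFormInChart_dForm hu hp, hK, 𝒥.fderiv_inChart_anticomm hp, map_neg]
      have h1 := hsymm a (𝒥.inChart p (extChartAt I p p) b)
      have h2 := hsymm b (𝒥.inChart p (extChartAt I p p) a)
      linarith
    exact (ddbar_apply_of_isInteriorPoint 𝒥 hp _ _).trans ((key v w _ _ (𝒥.inChart_self p v)
      (𝒥.inChart_self p w)).trans (ddbar_apply_of_isInteriorPoint 𝒥 hp v w).symm)

theorem isOneOne_gForm [FiniteDimensional ℝ E] [T2Space M] {𝒥 : ComplexStructure I M}
    (χ : RealOneOneForm 𝒥) {u : M → ℝ} (hu : ContMDiff I 𝓘(ℝ, ℝ) 2 u)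
    (hp : I.IsInteriorPoint p) : IsOneOne (𝒥.J p) (gForm χ u p) := by
  have h := isOneOne_ddbar 𝒥 hu hp
  refine ⟨fun v w ↦ ?_, fun v w ↦ ?_⟩
  · have h1 := χ.alternating p (v + w)
    simp only [map_add, add_apply, χ.alternating] at h1
    have h2 := h.neg_swap v w
    change χ.form p v w + ddbar 𝒥 u p v w = -(χ.form p w v + ddbar 𝒥 u p w v)
    linarith
  · exact congrArg₂ (· + ·) (χ.invariant p v w) (h.invariant v w)

end Nijenhuis

/-! ### Independence of the exterior derivative from the chart. -/

section ChartChange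

variable {E : Type*} [NormedAddCommGroup E] [NormedSpace ℝ E]
    {H : Type*} [TopologicalSpace H] {I : ModelWithCorners ℝ E H}
    {M : Type*} [TopologicalSpace M] [ChartedSpace H M] [IsManifold I ∞ M] {p x : M}

omit [IsManifold I ∞ M] in
theorem oneFormInChart_extChartAt (α : ∀ x : M, TangentSpace I x →L[ℝ] ℝ)
    (hx : x ∈ (extChartAt I p).source) (v : E) :
    oneFormInChart I α p (extChartAt I p x) v =
      α x (mfderivWithin 𝓘(ℝ, E) I (extChartAt I p).symm (range I) (extChartAt I p x) v) := by
  have h := congrArg (β := E →L[ℝ] ℝ) (fun z ↦ α z) ((extChartAt I p).left_inv hx)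
  exact congrArg (fun L : E →L[ℝ] ℝ ↦ L (mfderivWithin 𝓘(ℝ, E) I (extChartAt I p).symm (range I)
    (extChartAt I p x) v)) h

/-- The exterior derivative of a `1`-form may be computed in any chart. -/
theorem extDerivOneForm_apply_of_mem_source (α : ∀ x : M, TangentSpace I x →L[ℝ] ℝ)
    (hxp : x ∈ (extChartAt I p).source) (hx : I.IsInteriorPoint x)
    (hα : DifferentiableAt ℝ (oneFormInChart I α p) (extChartAt I p x)) (v w : TangentSpace I x) :
    extDerivOneForm I α x v w =
      fderiv ℝ (oneFormInChart I α p) (extChartAt I p x)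
          (mfderiv I 𝓘(ℝ, E) (extChartAt I p) x v) (mfderiv I 𝓘(ℝ, E) (extChartAt I p) x w) -
        fderiv ℝ (oneFormInChart I α p) (extChartAt I p x)
          (mfderiv I 𝓘(ℝ, E) (extChartAt I p) x w) (mfderiv I 𝓘(ℝ, E) (extChartAt I p) x v) := by
  set y := extChartAt I x x with hy
  set τ : E → E := extChartAt I p ∘ (extChartAt I x).symm with hτ
  have hτy : τ y = extChartAt I p x := by simp [hτ, hy]
  have hτc : ContDiffAt ℝ ∞ τ y :=
    ContMDiffAt.contDiffAt_comp_extChartAt_symm (k := ⊤)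
      (contMDiffAt_extChartAt' (by rwa [← extChartAt_source (I := I)])) hx
  have hmd : ∀ {m : M}, m ∈ (extChartAt I p).source →
      MDifferentiableAt I 𝓘(ℝ, E) (extChartAt I p) m := fun hm ↦
    mdifferentiableAt_extChartAt (by rwa [← extChartAt_source (I := I)])
  have heq : oneFormInChart I α x =ᶠ[𝓝 y]
      fun z ↦ (oneFormInChart I α p (τ z)).comp (fderiv ℝ τ z) := by
    have hs := hx.tendsto_symm.eventually ((isOpen_extChartAt_source (I := I) p).mem_nhds hxp)
    filter_upwards [hs, hx.eventually_nhds] with z hz hzt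
    rw [hτ, fderiv_comp_extChartAt_symm hzt.1 hzt.2 (hmd hz)]
    ext v
    have h1 := oneFormInChart_extChartAt (I := I) α hz
      (mfderiv I 𝓘(ℝ, E) (extChartAt I p) ((extChartAt I x).symm z)
        (mfderivWithin 𝓘(ℝ, E) I (extChartAt I x).symm (range I) z v))
    have h2 := congrArg (fun L ↦ L (mfderivWithin 𝓘(ℝ, E) I (extChartAt I x).symm (range I) z v))
      (mfderivWithin_extChartAt_symm_comp_mfderiv_extChartAt' (I := I) hz)
    exact (h1.trans (congrArg (α ((extChartAt I x).symm z)) h2)).symm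
  have hα' : HasFDerivAt (oneFormInChart I α p) (fderiv ℝ (oneFormInChart I α p)
      (extChartAt I p x)) (τ y) := by rw [hτy]; exact hα.hasFDerivAt
  have hτd : HasFDerivAt τ (fderiv ℝ τ y) y := (hτc.differentiableAt (by simp)).hasFDerivAt
  have hτdd : HasFDerivAt (fderiv ℝ τ) (fderiv ℝ (fderiv ℝ τ) y) y :=
    ((hτc.fderiv_right (m := 1) (by norm_cast)).differentiableAt (by simp)).hasFDerivAt
  have hsymm : IsSymmSndFDerivAt ℝ τ y := hτc.isSymmSndFDerivAt
    (by rw [minSmoothness_of_isRCLikeNormedField]; exact ENat.LEInfty.out)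
  have hder := ((hα'.comp y hτd).clm_comp hτdd).fderiv
  have hfd : ∀ a b : E, fderiv ℝ (oneFormInChart I α x) y a b =
      fderiv ℝ (oneFormInChart I α p) (extChartAt I p x) (fderiv ℝ τ y a) (fderiv ℝ τ y b) +
        oneFormInChart I α p (τ y) (fderiv ℝ (fderiv ℝ τ) y a b) := fun a b ↦ by
    rw [heq.fderiv_eq]
    refine (congrArg (fun L : E →L[ℝ] E →L[ℝ] ℝ ↦ L a b) hder).trans ?_
    simp [add_comm]
  have hD : ∀ a : E, fderiv ℝ τ y a = mfderiv I 𝓘(ℝ, E) (extChartAt I p) x a := by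
    intro a
    have h0 := hx.eventually_nhds.self_of_nhds
    have hz : (extChartAt I x).symm y = x := extChartAt_to_inv x
    have h1 := fderiv_comp_extChartAt_symm h0.1 h0.2
      (hmd (m := (extChartAt I x).symm (extChartAt I x x)) (by rw [← hy, hz]; exact hxp))
    have h2 := congrArg (fun L : E →L[ℝ] E ↦ L a) h1
    have h3 := congrArg (fun L : E →L[ℝ] E ↦ L a)
      (mfderivWithin_range_extChartAt_symm (I := I) (x := x))
    have h4 := congrArg (β := E →L[ℝ] E) (fun z ↦ mfderiv I 𝓘(ℝ, E) (extChartAt I p) z) hz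
    refine h2.trans ((congrArg (mfderiv I 𝓘(ℝ, E) (extChartAt I p)
      ((extChartAt I x).symm (extChartAt I x x))) h3).trans ?_)
    exact congrArg (fun L : E →L[ℝ] E ↦ L a) h4
  refine (extDerivOneForm_apply_of_isInteriorPoint hx α v w).trans ?_
  have key : ∀ a b : E, fderiv ℝ (oneFormInChart I α x) y a b -
      fderiv ℝ (oneFormInChart I α x) y b a = fderiv ℝ (oneFormInChart I α p) (extChartAt I p x)
        (fderiv ℝ τ y a) (fderiv ℝ τ y b) - fderiv ℝ (oneFormInChart I α p) (extChartAt I p x)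
        (fderiv ℝ τ y b) (fderiv ℝ τ y a) := fun a b ↦ by
    -- The second derivative of the transition map is symmetric, so it drops out after
    -- antisymmetrization.
    rw [hfd, hfd, hsymm a b]; ring
  refine (key v w).trans ?_
  exact congrArg₂ (fun a b ↦ fderiv ℝ (oneFormInChart I α p) (extChartAt I p x) a b -
    fderiv ℝ (oneFormInChart I α p) (extChartAt I p x) b a) (hD v) (hD w)

end ChartChange

/-! ### Limits of diagonal frames. -/

section LimitFrame

set_option synthInstance.maxHeartbeats 100000

variable {E : Type*} [NormedAddCommGroup E] [NormedSpace ℝ E] [FiniteDimensional ℝ E] {n : ℕ}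
  {ι : Type*}

omit [FiniteDimensional ℝ E] in
theorem tendsto_clm_apply {F : Type*} [NormedAddCommGroup F] [NormedSpace ℝ F] {l : Filter ι}
    {L : ι → E →L[ℝ] F} {L₀ : E →L[ℝ] F} {a : ι → E} {a₀ : E} (hL : Tendsto L l (𝓝 L₀))
    (ha : Tendsto a l (𝓝 a₀)) : Tendsto (fun k ↦ L k (a k)) l (𝓝 (L₀ a₀)) :=
  (isBoundedBilinearMap_apply.continuous.tendsto (L₀, a₀)).comp (hL.prodMk_nhds ha)

theorem exists_pos_norm_sq_le_of_pos {G : E →L[ℝ] E →L[ℝ] ℝ} (hG : ∀ v, v ≠ 0 → 0 < G v v) :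
    ∃ c : ℝ, 0 < c ∧ ∀ v, c * ‖v‖ ^ 2 ≤ G v v := by
  have : ProperSpace E := FiniteDimensional.proper ℝ E
  rcases subsingleton_or_nontrivial E with hE | hE
  · exact ⟨1, one_pos, fun v ↦ by simp [Subsingleton.elim v 0]⟩
  obtain ⟨v₀, hv₀, hmin⟩ := (isCompact_sphere (0 : E) 1).exists_isMinOn
    (NormedSpace.sphere_nonempty.2 zero_le_one) (f := fun v ↦ G v v)
    (by fun_prop)
  refine ⟨G v₀ v₀, hG v₀ (ne_zero_of_mem_unit_sphere ⟨v₀, hv₀⟩), fun v ↦ ?_⟩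
  rcases eq_or_ne v 0 with rfl | hv
  · simp
  have hvn : ‖v‖ ≠ 0 := norm_ne_zero_iff.2 hv
  have h := hmin (show ‖v‖⁻¹ • v ∈ Metric.sphere (0 : E) 1 by simp [norm_smul, hvn])
  simp only [map_smul, smul_apply, smul_eq_mul, mem_ofPred_eq] at h
  calc G v₀ v₀ * ‖v‖ ^ 2 ≤ (‖v‖⁻¹ * (‖v‖⁻¹ * G v v)) * ‖v‖ ^ 2 := by gcongr
    _ = G v v := by field_simp

theorem exists_norm_le_of_tendsto {l : Filter ι} {G : ι → E →L[ℝ] E →L[ℝ] ℝ}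
    {G₀ : E →L[ℝ] E →L[ℝ] ℝ} (hG : Tendsto G l (𝓝 G₀)) (hpos : ∀ v, v ≠ 0 → 0 < G₀ v v) :
    ∃ R : ℝ, ∀ᶠ k in l, ∀ v, G k v v = 1 → ‖v‖ ≤ R := by
  obtain ⟨c, hc, hle⟩ := exists_pos_norm_sq_le_of_pos hpos
  -- Once `G k` is within `c / 2` of `G₀`, it is bounded below by `c / 2` times the squared norm.
  refine ⟨√(2 / c), ?_⟩
  filter_upwards [Metric.tendsto_nhds (α := E →L[ℝ] E →L[ℝ] ℝ).1 hG (c / 2) (half_pos hc)] with k hk v hv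
  rw [dist_eq_norm (E := E →L[ℝ] E →L[ℝ] ℝ)] at hk
  have h1 : |(G k - G₀) v v| ≤ c / 2 * ‖v‖ ^ 2 := by
    calc |(G k - G₀) v v| ≤ ‖G k - G₀‖ * ‖v‖ * ‖v‖ := (G k - G₀).le_opNorm₂ v v
      _ ≤ c / 2 * ‖v‖ * ‖v‖ := by gcongr
      _ = _ := by ring
  have h2 := (abs_le.1 h1).1
  simp only [sub_apply, hv] at h2
  have h3 := (abs_le.1 h1).2
  simp only [sub_apply, hv] at h3
  have h4 := hle v
  refine Real.le_sqrt_of_sq_le ?_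
  rw [le_div_iff₀ hc]
  linarith

/-- Frame vectors are unit for metrics near `G₀`, hence bounded, so they converge along the
ultrafilter; the frame relations and the eigenvalues pass to the limit. -/
theorem IsDiagonalFrame.exists_tendsto {U : Ultrafilter ι} {G η : ι → E →L[ℝ] E →L[ℝ] ℝ}
    {K : ι → E →L[ℝ] E} {G₀ η₀ : E →L[ℝ] E →L[ℝ] ℝ} {K₀ : E →L[ℝ] E}
    (hG : Tendsto G U (𝓝 G₀)) (hη : Tendsto η U (𝓝 η₀)) (hK : Tendsto K U (𝓝 K₀))
    (hpos : ∀ v, v ≠ 0 → 0 < G₀ v v) {e : ι → Fin n → E} {lam : ι → Fin n → ℝ}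
    (he : ∀ᶠ k in U, IsDiagonalFrame (G k) (K k) (η k) (e k) (lam k)) :
    ∃ e₀ lam₀, IsDiagonalFrame G₀ K₀ η₀ e₀ lam₀ ∧ Tendsto lam U (𝓝 lam₀) := by
  have : ProperSpace E := FiniteDimensional.proper ℝ E
  obtain ⟨R, hR⟩ := exists_norm_le_of_tendsto hG hpos
  have hlim : ∀ i, ∃ v, Tendsto (fun k ↦ e k i) U (𝓝 v) := fun i ↦ by
    have hmem : ∀ᶠ k in U, e k i ∈ Metric.closedBall (0 : E) R := by
      filter_upwards [hR, he] with k hk hek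
      simpa using hk (e k i) (by simpa using hek.orthonormal i i)
    obtain ⟨v, -, hv⟩ := (isCompact_closedBall (0 : E) R).ultrafilter_le_nhds
      (U.map fun k ↦ e k i) (le_principal_iff.2 hmem)
    exact ⟨v, hv⟩
  choose e₀ he₀ using hlim
  have hB : ∀ {B : ι → E →L[ℝ] E →L[ℝ] ℝ} {B₀ : E →L[ℝ] E →L[ℝ] ℝ} {a b : ι → E} {a₀ b₀ : E},
      Tendsto B U (𝓝 B₀) → Tendsto a U (𝓝 a₀) → Tendsto b U (𝓝 b₀) →
      Tendsto (fun k ↦ B k (a k) (b k)) U (𝓝 (B₀ a₀ b₀)) := fun hB ha hb ↦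
    tendsto_clm_apply (tendsto_clm_apply hB ha) hb
  have hKe : ∀ i, Tendsto (fun k ↦ K k (e k i)) U (𝓝 (K₀ (e₀ i))) := fun i ↦
    tendsto_clm_apply hK (he₀ i)
  refine ⟨e₀, fun i ↦ η₀ (e₀ i) (K₀ (e₀ i)), ⟨⟨fun i j ↦ ?_, fun i j ↦ ?_⟩, fun i j ↦ ?_,
    fun i j ↦ ?_⟩, tendsto_pi_nhds.2 fun i ↦ ?_⟩
  · exact tendsto_nhds_unique (hB hG (he₀ i) (he₀ j))
      (tendsto_const_nhds.congr' (he.mono fun k hk ↦ (hk.orthonormal i j).symm))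
  · exact tendsto_nhds_unique (hB hG (he₀ i) (hKe j))
      (tendsto_const_nhds.congr' (he.mono fun k hk ↦ (hk.orthogonal i j).symm))
  · exact tendsto_nhds_unique (hB hη (he₀ i) (he₀ j))
      (tendsto_const_nhds.congr' (he.mono fun k hk ↦ (hk.isotropic i j).symm))
  · split_ifs with hij
    · rw [hij]
    · exact tendsto_nhds_unique (hB hη (he₀ i) (hKe j))
        (tendsto_const_nhds.congr' (he.mono fun k hk ↦ by simp [hk.diagonal i j, hij]))
  · exact (hB hη (he₀ i) (hKe i)).congr' (he.mono fun k hk ↦ by simp [hk.diagonal i i])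

end LimitFrame

/-! ### Continuity of the tensor fields in one fixed chart. -/

section Coordinates

theorem NormedAddCommGroup.continuousAt_add {X F : Type*} [TopologicalSpace X]
    [NormedAddCommGroup F] {a b : X → F} {x : X} (ha : ContinuousAt a x) (hb : ContinuousAt b x) :
    ContinuousAt (a + b) x := ha.add hb

theorem NormedSpace.continuousAt_const_smul_sub {X F : Type*} [TopologicalSpace X]
    [NormedAddCommGroup F] [NormedSpace ℝ F] {a b : X → F} {x : X} (c : ℝ)
    (ha : ContinuousAt a x) (hb : ContinuousAt b x) :
    ContinuousAt (fun y ↦ c • (a y - b y)) x := (ha.sub hb).const_smul c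

set_option synthInstance.maxHeartbeats 100000

variable {E : Type*} [NormedAddCommGroup E] [NormedSpace ℝ E]
    {H : Type*} [TopologicalSpace H] {I : ModelWithCorners ℝ E H}
    {M : Type*} [TopologicalSpace M] [ChartedSpace H M] [IsManifold I ∞ M]

/-- In the chart centred at `p`, the field `β` of bilinear forms is represented near `p` by a
function continuous at `p`. -/
def BilinearContinuousAt (β : ∀ x : M, TangentSpace I x →L[ℝ] TangentSpace I x →L[ℝ] ℝ)
    (p : M) : Prop :=
  ∃ B : M → E →L[ℝ] E →L[ℝ] ℝ, ContinuousAt B p ∧ ∀ᶠ x in 𝓝 p, ∀ v w : TangentSpace I x,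
    β x v w = B x (mfderiv I 𝓘(ℝ, E) (extChartAt I p) x v) (mfderiv I 𝓘(ℝ, E) (extChartAt I p) x w)

omit [IsManifold I ∞ M] in
theorem BilinearContinuousAt.add {β γ : ∀ x : M, TangentSpace I x →L[ℝ] TangentSpace I x →L[ℝ] ℝ}
    {p : M} (hβ : BilinearContinuousAt β p) (hγ : BilinearContinuousAt γ p) :
    BilinearContinuousAt (fun x ↦ β x + γ x) p := by
  obtain ⟨B, hB, hB'⟩ := hβ
  obtain ⟨C, hC, hC'⟩ := hγ
  refine ⟨B + C, NormedAddCommGroup.continuousAt_add (F := E →L[ℝ] E →L[ℝ] ℝ) hB hC, ?_⟩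
  filter_upwards [hB', hC'] with x h1 h2 v w
  exact congrArg₂ (· + ·) (h1 v w) (h2 v w)

theorem bilinearContinuousAt_of_contMDiff
    {β : ∀ x : M, TangentSpace I x →L[ℝ] TangentSpace I x →L[ℝ] ℝ}
    (hβ : ContMDiff I (I.prod 𝓘(ℝ, E →L[ℝ] E →L[ℝ] ℝ)) ∞
      (fun x ↦ TotalSpace.mk' (E →L[ℝ] E →L[ℝ] ℝ)
        (E := fun x : M ↦ TangentSpace I x →L[ℝ] TangentSpace I x →L[ℝ] ℝ) x (β x))) (p : M) :
    BilinearContinuousAt β p := by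
  refine ⟨_, (((contMDiffAt_hom_bundle _).1 (hβ p)).2).continuousAt, ?_⟩
  filter_upwards [(chartAt H p).open_source.mem_nhds (mem_chart_source H p)] with x hx v w
  have hbase : x ∈ (trivializationAt E (TangentSpace I : M → Type _) p).baseSet := by simpa using hx
  have hinv : ∀ v : TangentSpace I x,
      (trivializationAt E (TangentSpace I : M → Type _) p).symm x
        (mfderiv I 𝓘(ℝ, E) (extChartAt I p) x v : E) = v := fun v ↦ by
    have h1 := congrArg (fun L ↦ L v) (TangentBundle.continuousLinearMapAt_trivializationAt
      (I := I) hx)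
    have h2 := (trivializationAt E (TangentSpace I : M → Type _) p).symmL_continuousLinearMapAt
      (R := ℝ) hbase v
    exact (((trivializationAt E (TangentSpace I : M → Type _) p).symmL_apply (R := ℝ) hbase
      _).symm.trans (congrArg (fun z : E ↦ (trivializationAt E (TangentSpace I : M → Type _)
        p).symmL ℝ x z) h1).symm).trans h2
  have key : ∀ a b : E, ContinuousLinearMap.inCoordinates E (TangentSpace I) (E →L[ℝ] ℝ)
      (fun b : M ↦ TangentSpace I b →L[ℝ] ℝ) p x p x (β x) a b =
      β x ((trivializationAt E (TangentSpace I : M → Type _) p).symm x a)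
        ((trivializationAt E (TangentSpace I : M → Type _) p).symm x b) := fun a b ↦
    (inCoordinates_apply_eq₂ (𝕜 := ℝ) (ϕ := β x) (x₀ := p) (F₃ := ℝ) (E₃ := fun _ ↦ ℝ)
      (v := a) (w := b) hbase hbase (mem_univ _)).trans (by simp)
  refine ((key _ _).trans ?_).symm
  exact congrArg₂ (fun a b ↦ β x a b) (hinv v) (hinv w)

/-- `ddbar` at `x` is computed in the chart centred at `x`, so chart independence is needed to
express nearby values in the single chart at `p`. -/
theorem bilinearContinuousAt_ddbar (𝒥 : ComplexStructure I M) {u : M → ℝ}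
    (hu : ContMDiff I 𝓘(ℝ, ℝ) 2 u) {p : M} (hp : I.IsInteriorPoint p) :
    BilinearContinuousAt (ddbar 𝒥 u) p := by
  set A : E → E →L[ℝ] E →L[ℝ] ℝ := fderiv ℝ (oneFormInChart I (𝒥.dForm u) p) with hA
  have hc := 𝒥.contDiffAt_oneFormInChart_dForm hu hp
  have hAc : ContinuousAt A (extChartAt I p p) :=
    (hc.fderiv_right (m := 0) (by simp)).continuousAt
  refine ⟨fun x ↦ (-(1 / 2 : ℝ)) • (A (extChartAt I p x) - (A (extChartAt I p x)).flip), ?_, ?_⟩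
  · have h1 : ContinuousAt (fun x ↦ A (extChartAt I p x)) p :=
      ContinuousAt.comp (f := extChartAt I p) hAc (continuousAt_extChartAt p)
    have h2 : ContinuousAt (fun x ↦ (A (extChartAt I p x)).flip) p :=
      (ContinuousLinearMap.flipₗᵢ ℝ E E ℝ).continuous.continuousAt.comp h1
    exact NormedSpace.continuousAt_const_smul_sub (F := E →L[ℝ] E →L[ℝ] ℝ) _ h1 h2
  · have hd : ∀ᶠ y in 𝓝 (extChartAt I p p),
        DifferentiableAt ℝ (oneFormInChart I (𝒥.dForm u) p) y :=
      (hc.eventually (by simp)).mono fun z hz ↦ hz.differentiableAt (by simp)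
    have hint := (ModelWithCorners.isOpen_interior (I := I) (M := M) (n := ∞)
      (by simp)).mem_nhds hp
    filter_upwards [(isOpen_extChartAt_source (I := I) p).mem_nhds (mem_extChartAt_source p), hint,
      (continuousAt_extChartAt (I := I) p).eventually hd] with x hx hxi hxd v w
    exact congrArg (fun r ↦ -(1 / 2 : ℝ) * r)
      (extDerivOneForm_apply_of_mem_source (𝒥.dForm u) hx hxi hxd v w)

theorem ComplexStructure.exists_continuousAt_coord (𝒥 : ComplexStructure I M) (p : M) :
    ∃ K : M → E →L[ℝ] E, ContinuousAt K p ∧ ∀ᶠ x in 𝓝 p, ∀ v : TangentSpace I x,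
      (mfderiv I 𝓘(ℝ, E) (extChartAt I p) x (𝒥.J x v) : E) =
        K x (mfderiv I 𝓘(ℝ, E) (extChartAt I p) x v) := by
  refine ⟨_, (((contMDiffAt_hom_bundle _).1 (𝒥.smooth p)).2).continuousAt, ?_⟩
  filter_upwards [(chartAt H p).open_source.mem_nhds (mem_chart_source H p)] with x hx v
  have hx' : x ∈ (extChartAt I p).source := by rwa [extChartAt_source]
  simp only [ContinuousLinearMap.inCoordinates]
  rw [TangentBundle.continuousLinearMapAt_trivializationAt hx,
    TangentBundle.symmL_trivializationAt hx]
  have h := congrArg (fun L ↦ L v)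
    (mfderivWithin_extChartAt_symm_comp_mfderiv_extChartAt' (I := I) hx')
  exact (congrArg (fun z ↦ mfderiv I 𝓘(ℝ, E) (extChartAt I p) x (𝒥.J x z)) h).symm

end Coordinates

/-! ### Maximum principle and comparison of weak solutions. -/

section Comparison

variable {E : Type*} [NormedAddCommGroup E] [NormedSpace ℝ E]
    {H : Type*} [TopologicalSpace H] {I : ModelWithCorners ℝ E H}
    {M : Type*} [TopologicalSpace M] [ChartedSpace H M] [IsManifold I ∞ M]
    {𝒥 : ComplexStructure I M} {h : HermitianMetric 𝒥} {χ : RealOneOneForm 𝒥}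
    {n : ℕ} {Γ : Set (Fin n → ℝ)} {f : (Fin n → ℝ) → ℝ}

theorem HermitianMetric.isHermitianPair (h : HermitianMetric 𝒥) (x : M) :
    IsHermitianPair (h.g.inner x) (𝒥.J x) :=
  ⟨h.g.symm x, h.g.pos x, 𝒥.sq x, h.compat x⟩

theorem IsEigenvalues.exists_isDiagonalFrame {x : M}
    {η : TangentSpace I x →L[ℝ] TangentSpace I x →L[ℝ] ℝ} {lam : Fin n → ℝ}
    (hlam : IsEigenvalues h x η lam) :
    ∃ e, IsDiagonalFrame (h.g.inner x) (𝒥.J x) η e lam := by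
  obtain ⟨e, he⟩ := hlam
  refine ⟨e, ⟨⟨fun i j ↦ ?_, fun i j ↦ ?_⟩, fun i j ↦ (he i j).2.2.1, fun i j ↦ (he i j).2.2.2⟩⟩
  · exact (h.compat x (e i) (e j)).symm.trans (he i j).2.1
  · exact (h.g.symm x _ _).trans (he j i).1

variable [FiniteDimensional ℝ E] [T2Space M]

/-- In the interior, an admissible solution has an eigenvalue list that lies in the cone and
solves the equation. -/
theorem IsAdmissible.exists_isDiagonalFrame (hE : Module.finrank ℝ E = 2 * n)
    (hΓ : IsSymmetricCone Γ) (hf : IsEllipticConcave Γ f) {v q : M → ℝ}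
    (hv : IsAdmissible h χ Γ v) (hq : SolvesInInterior h χ f q v) {x : M}
    (hx : x ∈ I.interior M) :
    ∃ e lam, IsDiagonalFrame (h.g.inner x) (𝒥.J x) (gForm χ v x) e lam ∧ lam ∈ Γ ∧
      f lam = q x := by
  have : FiniteDimensional ℝ (TangentSpace I x) := inferInstanceAs (FiniteDimensional ℝ E)
  obtain ⟨lam, hlam, hmem⟩ := hv.2 x
  obtain ⟨lam', hlam', heq⟩ := hq x hx
  obtain ⟨e, he⟩ := hlam.exists_isDiagonalFrame
  obtain ⟨e', he'⟩ := hlam'.exists_isDiagonalFrame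
  -- Admissibility and the equation may supply different eigenvalue lists; `mem_cone` puts the
  -- second one in `Γ` too.
  exact ⟨e', lam', he', he.mem_cone hΓ hf (h.isHermitianPair x) hE (isOneOne_gForm χ hv.1 hx) he'
    hmem, heq⟩

/-- The maximum principle for admissible solutions. -/
theorem IsAdmissible.le_of_isMaxOn_sub (hE : Module.finrank ℝ E = 2 * n)
    (hΓ : IsSymmetricCone Γ) (hf : IsEllipticConcave Γ f) {v₁ q₁ v₂ q₂ : M → ℝ}
    (hv₁ : IsAdmissible h χ Γ v₁) (hq₁ : SolvesInInterior h χ f q₁ v₁)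
    (hv₂ : IsAdmissible h χ Γ v₂) (hq₂ : SolvesInInterior h χ f q₂ v₂) {x : M}
    (hx : x ∈ I.interior M) (hmax : ∀ y, v₁ y - v₂ y ≤ v₁ x - v₂ x) : q₁ x ≤ q₂ x := by
  have : FiniteDimensional ℝ (TangentSpace I x) := inferInstanceAs (FiniteDimensional ℝ E)
  obtain ⟨e₁, lam₁, he₁, hmem₁, heq₁⟩ := hv₁.exists_isDiagonalFrame hE hΓ hf hq₁ hx
  obtain ⟨e₂, lam₂, he₂, hmem₂, heq₂⟩ := hv₂.exists_isDiagonalFrame hE hΓ hf hq₂ hx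
  rw [← heq₁, ← heq₂]
  refine he₁.map_le_map hΓ hf (h.isHermitianPair x) hE (isOneOne_gForm χ hv₁.1 hx) he₂ hmem₁
    hmem₂ fun v ↦ ?_
  exact add_le_add_right (ddbar_apply_J_le_of_isMaxOn 𝒥 hv₁.1 hv₂.1 hx hmax v) _

/-- The right-hand side of the equation solved by an admissible function is continuous in the
interior. -/
theorem IsAdmissible.tendsto_rhs (hE : Module.finrank ℝ E = 2 * n)
    (hΓ : IsSymmetricCone Γ) (hf : IsEllipticConcave Γ f) {v q : M → ℝ}
    (hv : IsAdmissible h χ Γ v) (hq : SolvesInInterior h χ f q v) {p : M}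
    (hp : p ∈ I.interior M) {ι : Type*} {U : Ultrafilter ι} {x : ι → M}
    (hx : Tendsto x U (𝓝 p)) : Tendsto (fun k ↦ q (x k)) U (𝓝 (q p)) := by
  have : FiniteDimensional ℝ (TangentSpace I p) := inferInstanceAs (FiniteDimensional ℝ E)
  obtain ⟨G, hG, hG'⟩ := bilinearContinuousAt_of_contMDiff h.g.contMDiff p
  obtain ⟨N, hN, hN'⟩ := (bilinearContinuousAt_of_contMDiff χ.smooth p).add
    (bilinearContinuousAt_ddbar 𝒥 hv.1 hp)
  obtain ⟨K, hK, hK'⟩ := 𝒥.exists_continuousAt_coord p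
  have hint : ∀ᶠ k in U, x k ∈ I.interior M :=
    hx.eventually ((ModelWithCorners.isOpen_interior (I := I) (M := M) (n := ∞)
      (by simp)).mem_nhds hp)
  have hex : ∀ k, ∃ e lam, x k ∈ I.interior M →
      IsDiagonalFrame (h.g.inner (x k)) (𝒥.J (x k)) (gForm χ v (x k)) e lam ∧ lam ∈ Γ ∧
        f lam = q (x k) := fun k ↦ by
    by_cases hk : x k ∈ I.interior M
    · obtain ⟨e, lam, H⟩ := hv.exists_isDiagonalFrame hE hΓ hf hq hk
      exact ⟨e, lam, fun _ ↦ H⟩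
    · exact ⟨0, 0, fun hk' ↦ absurd hk' hk⟩
  choose e lam hframe using hex
  have hD : ∀ a : E, (mfderiv I 𝓘(ℝ, E) (extChartAt I p) p a : E) = a := fun a ↦
    congrArg (fun L : E →L[ℝ] E ↦ L a) (mfderiv_extChartAt_self (I := I) (x := p))
  have hGp : ∀ a b : E, h.g.inner p a b = G p a b := fun a b ↦
    (hG'.self_of_nhds a b).trans (congrArg₂ (fun a b ↦ G p a b) (hD a) (hD b))
  have hNp : ∀ a b : E, gForm χ v p a b = N p a b := fun a b ↦
    (hN'.self_of_nhds a b).trans (congrArg₂ (fun a b ↦ N p a b) (hD a) (hD b))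
  have hKp : ∀ a : E, 𝒥.J p a = K p a := fun a ↦
    (hD _).symm.trans ((hK'.self_of_nhds a).trans (congrArg (K p) (hD a)))
  have hcoord : ∀ᶠ k in U, IsDiagonalFrame (G (x k)) (K (x k)) (N (x k))
      (fun i ↦ (mfderiv I 𝓘(ℝ, E) (extChartAt I p) (x k) (e k i) : E)) (lam k) := by
    filter_upwards [hint, hx.eventually hG', hx.eventually hN', hx.eventually hK'] with
      k hk hGk hNk hKk
    have H := (hframe k hk).1
    refine ⟨⟨fun i j ↦ ?_, fun i j ↦ ?_⟩, fun i j ↦ ?_, fun i j ↦ ?_⟩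
    · exact (hGk _ _).symm.trans (H.orthonormal i j)
    · exact (congrArg (G (x k) _) (hKk _)).symm.trans ((hGk _ _).symm.trans (H.orthogonal i j))
    · exact (hNk _ _).symm.trans (H.isotropic i j)
    · exact (congrArg (N (x k) _) (hKk _)).symm.trans ((hNk _ _).symm.trans (H.diagonal i j))
  obtain ⟨e₀, lam₀, he₀, hlam₀⟩ := IsDiagonalFrame.exists_tendsto (hG.tendsto.comp hx)
    (hN.tendsto.comp hx) (hK.tendsto.comp hx)
    (fun a ha ↦ (hGp a a) ▸ h.g.pos p a ha) hcoord
  have hframe₀ : IsDiagonalFrame (h.g.inner p) (𝒥.J p) (gForm χ v p) e₀ lam₀ := by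
    refine ⟨⟨fun i j ↦ ?_, fun i j ↦ ?_⟩, fun i j ↦ ?_, fun i j ↦ ?_⟩
    · exact (hGp _ _).trans (he₀.orthonormal i j)
    · exact (congrArg (h.g.inner p (e₀ i)) (hKp _)).trans ((hGp _ _).trans (he₀.orthogonal i j))
    · exact (hNp _ _).trans (he₀.isotropic i j)
    · exact (congrArg (gForm χ v p (e₀ i)) (hKp _)).trans ((hNp _ _).trans (he₀.diagonal i j))
  obtain ⟨e', lam', he', hmem', heq'⟩ := hv.exists_isDiagonalFrame hE hΓ hf hq hp
  have hone := isOneOne_gForm χ hv.1 hp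
  have hpair := h.isHermitianPair p
  have hmem₀ := he'.mem_cone hΓ hf hpair hE hone hframe₀ hmem'
  -- The limit list need not be the one given at `p`; monotonicity applied both ways to the same
  -- form identifies the values of `f`.
  have hval : f lam₀ = q p := heq' ▸ le_antisymm
    (hframe₀.map_le_map hΓ hf hpair hE hone he' hmem₀ hmem' fun _ ↦ le_rfl)
    (he'.map_le_map hΓ hf hpair hE hone hframe₀ hmem' hmem₀ fun _ ↦ le_rfl)
  rw [← hval]
  have hfc : ContinuousAt f lam₀ := hf.smooth.continuousOn.continuousAt (hΓ.isOpen.mem_nhds hmem₀)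
  exact (hfc.tendsto.comp hlam₀).congr' (hint.mono fun k hk ↦ (hframe k hk).2.2)

omit [FiniteDimensional ℝ E] [T2Space M] in
theorem IsWeakC0Solution.eq_boundary {ψ u : M → ℝ} {φ : I.boundary M → ℝ}
    (hu : IsWeakC0Solution h χ Γ f ψ φ u) (y : I.boundary M) : u y = φ y := by
  obtain ⟨-, C, -, hC⟩ := hu
  refine eq_of_abs_sub_nonpos (le_of_forall_pos_le_add fun ε hε ↦ ?_)
  obtain ⟨v, ρ, -, hv, -, -, hb⟩ := hC ε hε
  rw [← hb y]
  rw [zero_add]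
  exact (hv y).le

/-- One-sided comparison of weak solutions by their boundary data. -/
theorem IsWeakC0Solution.sub_le [CompactSpace M] (hE : Module.finrank ℝ E = 2 * n)
    (hΓ : IsSymmetricCone Γ) (hf : IsEllipticConcave Γ f) {ψ u₁ u₂ : M → ℝ}
    (hψ : Continuous ψ) {φ₁ φ₂ : I.boundary M → ℝ}
    (h₁ : IsWeakC0Solution h χ Γ f ψ φ₁ u₁) (h₂ : IsWeakC0Solution h χ Γ f ψ φ₂ u₂)
    {S : ℝ} (hS : ∀ y, φ₁ y - φ₂ y ≤ S) (x₀ : M) : u₁ x₀ - u₂ x₀ ≤ S := by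
  refine le_of_forall_pos_le_add fun ε hε ↦ ?_
  obtain ⟨-, C₁, -, hC₁⟩ := h₁
  obtain ⟨v₁, ρ₁, hv₁, hclose₁, hρ₁, hsol₁, hbdry₁⟩ := hC₁ ε hε
  suffices v₁ x₀ - u₂ x₀ ≤ S by linarith [(abs_lt.1 (hclose₁ x₀)).2]
  obtain ⟨hu₂, C, hC, hC₂⟩ := id h₂
  set δ : ℕ → ℝ := fun k ↦ 1 / ((k : ℝ) + 1)
  have hδ : ∀ k, 0 < δ k := fun k ↦ Nat.one_div_pos_of_nat
  have hδ0 : Tendsto δ (hyperfilter ℕ) (𝓝 0) :=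
    tendsto_one_div_add_atTop_nhds_zero_nat.mono_left Nat.hyperfilter_le_atTop
  choose v₂ ρ₂ hv₂ hclose₂ hρ₂ hsol₂ hbdry₂ using fun k ↦ hC₂ (δ k) (hδ k)
  have hmax : ∀ k, ∃ x, ∀ y, v₁ y - v₂ k y ≤ v₁ x - v₂ k x := fun k ↦ by
    obtain ⟨x, -, hx⟩ := isCompact_univ.exists_isMaxOn ⟨x₀, mem_univ _⟩
      (hv₁.1.continuous.sub (hv₂ k).1.continuous).continuousOn
    exact ⟨x, fun y ↦ hx (mem_univ y)⟩
  choose x hx using hmax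
  -- An ultrafilter limit replaces a convergent subsequence.
  obtain ⟨p, -, hp⟩ := isCompact_univ.ultrafilter_le_nhds ((hyperfilter ℕ).map x) (by simp)
  replace hp : Tendsto x (hyperfilter ℕ) (𝓝 p) := hp
  rcases I.isInteriorPoint_or_isBoundaryPoint p with hint | hbd
  · exfalso
    -- No regularity of `ρ₁` is assumed; its continuity at `p` comes from being the difference of
    -- `F(𝔤[v₁])` and `ψ`.
    have hlim := hv₁.tendsto_rhs hE hΓ hf hsol₁ hint hp
    have hlimψ := (hψ.tendsto p).comp hp
    have hlimρ : Tendsto (fun k ↦ ρ₁ (x k)) (hyperfilter ℕ) (𝓝 (ρ₁ p)) := by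
      simpa using hlim.sub hlimψ
    have hCδ : Tendsto (fun k ↦ C (δ k)) (hyperfilter ℕ) (𝓝 0) :=
      hC.comp (tendsto_nhdsWithin_iff.2 ⟨hδ0, Eventually.of_forall hδ⟩)
    have hxint : ∀ᶠ k in hyperfilter ℕ, x k ∈ I.interior M :=
      hp.eventually ((ModelWithCorners.isOpen_interior (I := I) (M := M) (n := ∞)
        (by simp)).mem_nhds hint)
    refine (hρ₁ p hint).1.not_ge (le_of_tendsto_of_tendsto hlimρ hCδ ?_)
    filter_upwards [hxint] with k hk
    have hle := hv₁.le_of_isMaxOn_sub hE hΓ hf hsol₁ (hv₂ k) (hsol₂ k) hk (hx k)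
    linarith [(hρ₂ k (x k) hk).2]
  -- One `δ k` pays for replacing `v₂ k` by `u₂` at `x₀`, the other at `x k`.
  · have hlim : Tendsto (fun k ↦ v₁ (x k) - u₂ (x k) + δ k + δ k) (hyperfilter ℕ)
        (𝓝 (v₁ p - u₂ p + 0 + 0)) :=
      ((((hv₁.1.continuous.sub hu₂).tendsto p).comp hp).add hδ0).add hδ0
    have hle : v₁ x₀ - u₂ x₀ ≤ v₁ p - u₂ p + 0 + 0 := by
      refine ge_of_tendsto' hlim fun k ↦ ?_
      linarith [hx k x₀, (abs_lt.1 (hclose₂ k x₀)).2, (abs_lt.1 (hclose₂ k x₀)).1,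
        (abs_lt.1 (hclose₂ k (x k))).1, (abs_lt.1 (hclose₂ k (x k))).2]
    have hb₁ := hbdry₁ ⟨p, hbd⟩
    have hb₂ := h₂.eq_boundary ⟨p, hbd⟩
    simp only at hb₁ hb₂
    linarith [hS ⟨p, hbd⟩]

end Comparison

theorem theorem7p2 (n : ℕ) [NeZero n] (hn : 2 ≤ n)
    (M : Type*) [TopologicalSpace M] [T2Space M] [CompactSpace M]
    [ChartedSpace (EuclideanHalfSpace (2 * n)) M] [IsManifold (𝓡∂ (2 * n)) ∞ M]
    (𝒥 : ComplexStructure (𝓡∂ (2 * n)) M) (h : HermitianMetric 𝒥) (χ : RealOneOneForm 𝒥)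
    (Γ : Set (Fin n → ℝ)) (f : (Fin n → ℝ) → ℝ)
    (hΓ : IsSymmetricCone Γ) (hf : IsEllipticConcave Γ f)
    (ψ : M → ℝ) (hψ : Continuous ψ)
    (hdeg : (⨅ x ∈ (𝓡∂ (2 * n)).interior M, (ψ x : EReal)) = supBoundary Γ f) :
    (∀ (φ₁ φ₂ : (𝓡∂ (2 * n)).boundary M → ℝ) (u₁ u₂ : M → ℝ),
      IsWeakC0Solution h χ Γ f ψ φ₁ u₁ → IsWeakC0Solution h χ Γ f ψ φ₂ u₂ →
        (⨆ x : M, |u₁ x - u₂ x|) ≤ ⨆ y : (𝓡∂ (2 * n)).boundary M, |φ₁ y - φ₂ y|) ∧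
    (∀ (φ : (𝓡∂ (2 * n)).boundary M → ℝ) (u v : M → ℝ),
      IsWeakC0Solution h χ Γ f ψ φ u → IsWeakC0Solution h χ Γ f ψ φ v → u = v) := by
  have hE : Module.finrank ℝ (EuclideanSpace ℝ (Fin (2 * n))) = 2 * n := by simp
  refine ⟨fun φ₁ φ₂ u₁ u₂ h₁ h₂ ↦ ?_, fun φ u v hu hv ↦ funext fun x ↦ le_antisymm ?_ ?_⟩
  -- The real supremum of an unbounded family is 0, so boundedness must be checked. The boundary
  -- data are restrictions of continuous functions on a compact space.
  · have hbdd : BddAbove (range fun y : (𝓡∂ (2 * n)).boundary M ↦ |φ₁ y - φ₂ y|) := by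
      obtain ⟨R, hR⟩ := (isCompact_range (h₁.1.sub h₂.1).abs).bddAbove
      refine ⟨R, ?_⟩
      rintro _ ⟨y, rfl⟩
      simp only [← h₁.eq_boundary, ← h₂.eq_boundary]
      exact hR ⟨y, rfl⟩
    refine Real.iSup_le (fun x ↦ abs_le.2 ⟨?_, ?_⟩) (Real.iSup_nonneg fun _ ↦ abs_nonneg _)
    · have := h₂.sub_le hE hΓ hf hψ h₁
        (fun y ↦ ((le_abs_self _).trans_eq (abs_sub_comm _ _)).trans (le_ciSup hbdd y)) x
      linarith
    · exact h₁.sub_le hE hΓ hf hψ h₂ (fun y ↦ (le_abs_self _).trans (le_ciSup hbdd y)) x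
  · exact sub_nonpos.1 (hu.sub_le hE hΓ hf hψ hv (fun y ↦ by simp) x)
  · exact sub_nonpos.1 (hv.sub_le hE hΓ hf hψ hu (fun y ↦ by simp) x)
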